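/- Let $\mathbb{S}^n$ be the space of complex symmetric $n\times n$ matrices. Let $\mathcal{L}$ be a d-pencil, that is, a two-dimensional real linear space of real symmetric $n\times n$ matrices that contains a positive definite matrix, and let $\mathcal{L}_{\mathbb{C}}\subset\mathbb{S}^n$ be its complexification. Let $r$ be its number of distinct eigenvalues, that is, the number of distinct complex roots $\alpha$ of $\det(A-\alpha B)$, where $\{A,B\}$ is a basis of $\mathcal{L}_{\mathbb{C}}$ with $\det(B)\neq 0$. Then $r\ge 2$ and $$\mathrm{mld}(\mathcal{L})=\deg(\mathcal{L}^{-1})=r-1,\qquad \mathrm{rmld}(\mathcal{L})=2r-3 .$$ Here $\mathcal{L}^{-1}\subset\mathbb{S}^n$ is the Zariski closure of the set of inverses of all invertible matrices in $\mathcal{L}_{\mathbb{C}}$, and $\deg(\mathcal{L}^{-1})$ is the degree of the projective curve that is the Zariski closure of this set of inverses in $\mathbb{P}(\mathbb{S}^n)$, i.e. the number of points in which a generic hyperplane meets the curve. For $S\in\mathbb{S}^n$ let $\ell_S(M)=\log\det(M)-\mathrm{trace}(SM)$; a critical point of $\ell_S$ on a variety $X\subset\mathbb{S}^n$ is an invertible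 matrix $M\in X$ such that the differential of $\ell_S$ at $M$ vanishes on the tangent space of $X$ at $M$. The ML degree $\mathrm{mld}(\mathcal{L})$ and the reciprocal ML degree $\mathrm{rmld}(\mathcal{L})$ are the numbers of complex critical points of $\ell_S$ on $\mathcal{L}_{\mathbb{C}}$ and on $\mathcal{L}^{-1}$, respectively, for generic $S\in\mathbb{S}^n$. Moreover, this applies to every two-dimensional linear Gaussian model: if $\mathcal{L}$ is a two-dimensional real linear space of real symmetric $n\times n$ matrices, and there is a nondegenerate Gaussian distribution on $\mathbb{R}^n$ whose concentration matrix, or whose covariance matrix, lies in $\mathcal{L}$, then $\mathcal{L}$ is a d-pencil. -/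

import Mathlib

open scoped LinearAlgebra.Projectivization

noncomputable section

namespace Pencil

/-- The space `𝕊ⁿ` of complex symmetric `n × n` matrices. -/
def symMatrices (n : ℕ) : Submodule ℂ (Matrix (Fin n) (Fin n) ℂ) where
  carrier := {M | M.IsSymm}
  zero_mem' := Matrix.isSymm_zero
  add_mem' := fun hA hB => hA.add hB
  smul_mem' := fun c _ hA => hA.smul c

/-- Polynomials in the entries `x i j` of an `n × n` matrix. -/
abbrev MatrixPoly (n : ℕ) : Type := MvPolynomial (Fin n × Fin n) ℂ

/-- The value of a polynomial in the matrix entries at the matrix `M`. -/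
def evalAt {n : ℕ} (M : Matrix (Fin n) (Fin n) ℂ) (F : MatrixPoly n) : ℂ :=
  MvPolynomial.eval (fun ij => M ij.1 ij.2) F

/-- `P S` holds for generic `S ∈ 𝕊ⁿ`: it holds for all symmetric matrices outside the zero set
of some polynomial that does not vanish identically on `𝕊ⁿ`. -/
def ForGenericSymm {n : ℕ} (P : Matrix (Fin n) (Fin n) ℂ → Prop) : Prop :=
  ∃ F : MatrixPoly n, (∃ S ∈ symMatrices n, evalAt S F ≠ 0) ∧
    ∀ S ∈ symMatrices n, evalAt S F ≠ 0 → P S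

/-- The complex linear span of a real linear space of matrices. -/
def complexify {n : ℕ} (L : Submodule ℝ (Matrix (Fin n) (Fin n) ℝ)) :
    Submodule ℂ (Matrix (Fin n) (Fin n) ℂ) :=
  Submodule.span ℂ ((fun M : Matrix (Fin n) (Fin n) ℝ => M.map Complex.ofReal) '' (L : Set _))

/-- A real pencil: a two-dimensional linear space of real symmetric matrices. -/
structure IsRealPencil {n : ℕ} (L : Submodule ℝ (Matrix (Fin n) (Fin n) ℝ)) : Prop where
  isSymm : ∀ M ∈ L, M.IsSymm
  finrank_eq : Module.finrank ℝ L = 2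

/-- A d-pencil: a real pencil that contains a positive definite matrix. -/
structure IsDPencil {n : ℕ} (L : Submodule ℝ (Matrix (Fin n) (Fin n) ℝ)) : Prop
    extends IsRealPencil L where
  exists_posDef : ∃ M ∈ L, M.PosDef

/-- The pencil `L` has exactly `r` distinct eigenvalues: for a spanning pair `A, B` of `L` with
`B` invertible, the polynomial `det (A - α B)` has exactly `r` distinct complex roots `α`. -/
def HasDistinctEigenvalues {n : ℕ} (L : Submodule ℂ (Matrix (Fin n) (Fin n) ℂ)) (r : ℕ) : Prop :=
  ∃ A B : Matrix (Fin n) (Fin n) ℂ, L = Submodule.span ℂ {A, B} ∧ B.det ≠ 0 ∧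
    {α : ℂ | (A - α • B).det = 0}.encard = r

/-- The set of inverses of all invertible matrices in `L`. -/
def inverses {n : ℕ} (L : Submodule ℂ (Matrix (Fin n) (Fin n) ℂ)) :
    Set (Matrix (Fin n) (Fin n) ℂ) :=
  {N | ∃ M ∈ L, M.det ≠ 0 ∧ N = M⁻¹}

/-! ### The reciprocal curve and its degree -/

/-- Zariski closure of a set of points of the projective space `ℙ(𝕊ⁿ)`. -/
def projClosure {n : ℕ} (X : Set (ℙ ℂ (symMatrices n))) : Set (ℙ ℂ (symMatrices n)) :=
  {p | ∀ (k : ℕ) (F : MatrixPoly n), F.IsHomogeneous k →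
    (∀ q ∈ X, evalAt (q.rep : Matrix (Fin n) (Fin n) ℂ) F = 0) →
      evalAt (p.rep : Matrix (Fin n) (Fin n) ℂ) F = 0}

/-- The reciprocal curve `ℙ L⁻¹`: the Zariski closure in `ℙ(𝕊ⁿ)` of the set of points
represented by the inverses of the invertible matrices in `L`. -/
def reciprocalCurve {n : ℕ} (L : Submodule ℂ (Matrix (Fin n) (Fin n) ℂ)) :
    Set (ℙ ℂ (symMatrices n)) :=
  projClosure {p | ∃ (N : symMatrices n) (hN : N ≠ 0),
    (N : Matrix (Fin n) (Fin n) ℂ) ∈ inverses L ∧ p = Projectivization.mk ℂ N hN}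

/-- The projective curve `X ⊆ ℙ(𝕊ⁿ)` has degree `d`: a generic hyperplane of `ℙ(𝕊ⁿ)` meets it in
exactly `d` points. Hyperplanes are the zero sets of `M ↦ trace (H M)` with `H ∈ 𝕊ⁿ`. -/
def HasCurveDegree {n : ℕ} (X : Set (ℙ ℂ (symMatrices n))) (d : ℕ) : Prop :=
  ForGenericSymm fun H : Matrix (Fin n) (Fin n) ℂ =>
    {p ∈ X | (H * (p.rep : Matrix (Fin n) (Fin n) ℂ)).trace = 0}.encard = d

/-! ### Critical points of the log-likelihood function -/

/-- Zariski closure of a set of matrices. -/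
def zariskiClosure {n : ℕ} (X : Set (Matrix (Fin n) (Fin n) ℂ)) :
    Set (Matrix (Fin n) (Fin n) ℂ) :=
  {M | ∀ F : MatrixPoly n, (∀ N ∈ X, evalAt N F = 0) → evalAt M F = 0}

/-- The Zariski tangent space at `M` of a variety `X` of matrices: the directions that are
annihilated by the differentials at `M` of all polynomials vanishing on `X`. -/
def tangentSpace {n : ℕ} (X : Set (Matrix (Fin n) (Fin n) ℂ)) (M : Matrix (Fin n) (Fin n) ℂ) :
    Set (Matrix (Fin n) (Fin n) ℂ) :=
  {T | ∀ F : MatrixPoly n, (∀ N ∈ X, evalAt N F = 0) →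
    ∑ i, ∑ j, T i j * evalAt M (MvPolynomial.pderiv (i, j) F) = 0}

/-- The differential at an invertible matrix `M`, in the direction `T`, of the log-likelihood
function `ℓ_S(M) = log (det M) - trace (S M)`. By the logarithmic derivative it does not depend on
a branch of the complex logarithm. -/
def dLogLikelihood {n : ℕ} (S M T : Matrix (Fin n) (Fin n) ℂ) : ℂ :=
  logDeriv (fun t : ℂ => (M + t • T).det) 0 - deriv (fun t : ℂ => (S * (M + t • T)).trace) 0

/-- The complex critical points of `ℓ_S` on a variety `X`: the invertible matrices `M ∈ X` at which
the gradient of `ℓ_S` is normal to `X`, that is, the differential of `ℓ_S` vanishes on the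
tangent space of `X`. -/
def criticalPoints {n : ℕ} (X : Set (Matrix (Fin n) (Fin n) ℂ)) (S : Matrix (Fin n) (Fin n) ℂ) :
    Set (Matrix (Fin n) (Fin n) ℂ) :=
  {M | M ∈ X ∧ M.det ≠ 0 ∧ ∀ T ∈ tangentSpace X M, dLogLikelihood S M T = 0}

/-- The reciprocal variety `L⁻¹`: the Zariski closure of the set of inverses. -/
def reciprocalVariety {n : ℕ} (L : Submodule ℂ (Matrix (Fin n) (Fin n) ℂ)) :
    Set (Matrix (Fin n) (Fin n) ℂ) :=
  zariskiClosure (inverses L)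

/-- `mld(L) = m`: for generic `S ∈ 𝕊ⁿ`, the function `ℓ_S` has exactly `m` complex critical
points on `L`. -/
def HasMLDegree {n : ℕ} (L : Submodule ℂ (Matrix (Fin n) (Fin n) ℂ)) (m : ℕ) : Prop :=
  ForGenericSymm fun S : Matrix (Fin n) (Fin n) ℂ =>
    (criticalPoints (L : Set (Matrix (Fin n) (Fin n) ℂ)) S).encard = m

/-- `rmld(L) = m`: for generic `S ∈ 𝕊ⁿ`, the function `ℓ_S` has exactly `m` complex critical
points on `L⁻¹`. -/
def HasReciprocalMLDegree {n : ℕ} (L : Submodule ℂ (Matrix (Fin n) (Fin n) ℂ)) (m : ℕ) : Prop :=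
  ForGenericSymm fun S : Matrix (Fin n) (Fin n) ℂ =>
    (criticalPoints (reciprocalVariety L) S).encard = m

/-! ### Linear Gaussian models -/

/-- The linear covariance model of `L`: the nondegenerate Gaussian distributions on `ℝⁿ` whose
covariance matrix lies in `L`. -/
def linearCovarianceModel {n : ℕ} (L : Submodule ℝ (Matrix (Fin n) (Fin n) ℝ)) :
    Set (MeasureTheory.Measure (EuclideanSpace ℝ (Fin n))) :=
  {P | ∃ (μ : EuclideanSpace ℝ (Fin n)) (C : Matrix (Fin n) (Fin n) ℝ),
    C.PosDef ∧ C ∈ L ∧ P = ProbabilityTheory.multivariateGaussian μ C}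

/-- The linear concentration model of `L`: the nondegenerate Gaussian distributions on `ℝⁿ` whose
concentration matrix (the inverse of the covariance matrix) lies in `L`. -/
def linearConcentrationModel {n : ℕ} (L : Submodule ℝ (Matrix (Fin n) (Fin n) ℝ)) :
    Set (MeasureTheory.Measure (EuclideanSpace ℝ (Fin n))) :=
  {P | ∃ (μ : EuclideanSpace ℝ (Fin n)) (C : Matrix (Fin n) (Fin n) ℝ),
    C.PosDef ∧ C⁻¹ ∈ L ∧ P = ProbabilityTheory.multivariateGaussian μ C}

end Pencil

end

/-!
The proof rests on diagonalising the whole pencil at once. Since `L` contains a positive definite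
matrix, there are an invertible complex matrix `Q` and numbers `lam i`, with exactly `r` distinct
values, such that the complexification of `L` consists of the matrices
`Q * diagonal (x * lam + y) * Qᵀ` (`IsDPencil.exists_eq_diagPencil`). The numbers `lam i` are not
all equal, because the complexification is not a line; hence `2 ≤ r`.

In these coordinates the inverses have diagonal entries `1 / (x * lam i + y)`, up to the congruence
by the inverse of `Qᵀ`. The closure of the set of inverses satisfies explicit equations:
off-diagonal entries vanish, entries belonging to equal `lam i` agree, and the quadrics
`reciprocalQuadric` hold, which say that the reciprocals of the entries are values of an affine
function. By `mem_inverses_or_single` the common zeros of these equations are the inverses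
themselves and the matrices supported on one eigenvalue. The differentials of the same equations
determine the tangent space at an inverse (`mem_tangentSpace_reciprocalVariety`).

Each of the three numbers thereby becomes the number of points `(x : y)` of the projective line at
which a rational function vanishes. With `k i = x * lam i + y` and with `w` the relevant diagonal
entries of the generic symmetric matrix, the functions are

* `t * ∑ i, lam i / k i - s * ∑ i, 1 / k i`, where `t = ∑ i, w i` and `s = ∑ i, w i * lam i`, for
  the critical points on the pencil (`encard_mlSolutions`);
* `∑ i, w i / k i` for the hyperplane sections of the reciprocal curve
  (`hasCurveDegree_diagPencil`);
* `(∑ i, 1 / k i) * ∑ i, w i * lam i / k i ^ 2 - (∑ i, lam i / k i) * ∑ i, w i / k i ^ 2` for the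
  critical points on the reciprocal variety (`encard_reciprocalMLSolutions`).

In the chart `x = 1` their numerators are polynomials of degree at most `r - 1`, `r - 1` and
`2 * r - 3`, depending linearly on `w`. The three linear systems have no base points, neither in the
affine line nor at infinity, so by Bertini's theorem on the projective line
(`forGenericSymm_separable`) the generic member has the maximal degree and simple roots, and it
avoids the finitely many points where some `k i` vanishes. Counting its roots gives the theorem.

The statement on Gaussian models holds because a nondegenerate Gaussian distribution has a positive
definite covariance matrix, whose inverse is positive definite as well.
-/

namespace Pencil

open Polynomial

/-! ### Generic symmetric matrices -/

section Generic

variable {n : ℕ}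

theorem ForGenericSymm.mono {P R : Matrix (Fin n) (Fin n) ℂ → Prop} (hP : ForGenericSymm P)
    (h : ∀ S ∈ symMatrices n, P S → R S) : ForGenericSymm R := by
  obtain ⟨F, hF, hFP⟩ := hP
  exact ⟨F, hF, fun S hS hSF => h S hS (hFP S hS hSF)⟩

/-- Two generic conditions hold generically at the same time: on the line through a witness of the
first and a witness of the second, both polynomials are nonzero polynomials in one variable. -/
theorem ForGenericSymm.and {P R : Matrix (Fin n) (Fin n) ℂ → Prop} (hP : ForGenericSymm P)
    (hR : ForGenericSymm R) : ForGenericSymm fun S => P S ∧ R S := by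
  obtain ⟨F, ⟨S₁, hS₁, hF⟩, hFP⟩ := hP
  obtain ⟨G, ⟨S₂, hS₂, hG⟩, hGR⟩ := hR
  let line : MatrixPoly n →ₐ[ℂ] ℂ[X] :=
    MvPolynomial.aeval fun ij => C (S₁ ij.1 ij.2) + X * C (S₂ ij.1 ij.2 - S₁ ij.1 ij.2)
  have hline : ∀ (z : ℂ) (H : MatrixPoly n),
      (line H).eval z = evalAt (S₁ + z • (S₂ - S₁)) H := by
    intro z H
    have : (Polynomial.evalRingHom z).comp (line : MatrixPoly n →+* ℂ[X]) =
        MvPolynomial.eval fun ij => (S₁ + z • (S₂ - S₁)) ij.1 ij.2 := by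
      apply MvPolynomial.ringHom_ext
      · intro a; simp [line]
      · intro ij; simp [line]
    exact congrArg (fun f : MatrixPoly n →+* ℂ => f H) this
  have hF' : line F ≠ 0 := fun h => hF (by simpa [h] using (hline 0 F).symm)
  have hG' : line G ≠ 0 := fun h => hG (by simpa [h] using (hline 1 G).symm)
  obtain ⟨z, hz⟩ : ∃ z, (line F * line G).eval z ≠ 0 := by
    by_contra! h
    exact mul_ne_zero hF' hG' (Polynomial.funext (by simpa using h))
  rw [eval_mul, hline, hline] at hz
  refine ⟨F * G, ⟨S₁ + z • (S₂ - S₁), ?_, ?_⟩, fun S hS hFG => ?_⟩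
  · exact add_mem hS₁ (Submodule.smul_mem _ _ (sub_mem hS₂ hS₁))
  · simpa [evalAt] using hz
  · have : evalAt S F * evalAt S G ≠ 0 := by simpa [evalAt] using hFG
    exact ⟨hFP S hS (left_ne_zero_of_mul this), hGR S hS (right_ne_zero_of_mul this)⟩

/-- The linear polynomial in the matrix entries whose values are those of a linear form. -/
noncomputable def linForm (φ : Matrix (Fin n) (Fin n) ℂ →ₗ[ℂ] ℂ) : MatrixPoly n :=
  ∑ ij : Fin n × Fin n, MvPolynomial.C (φ (Matrix.single ij.1 ij.2 1)) * MvPolynomial.X ij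

theorem sum_entries_mul_map_single {V : Type*} [AddCommGroup V] [Module ℂ V]
    (φ : Matrix (Fin n) (Fin n) ℂ →ₗ[ℂ] V) (M : Matrix (Fin n) (Fin n) ℂ) :
    ∑ ij : Fin n × Fin n, M ij.1 ij.2 • φ (Matrix.single ij.1 ij.2 1) = φ M := by
  conv_rhs => rw [Matrix.matrix_eq_sum_single M]
  rw [Fintype.sum_prod_type]
  simp only [map_sum]
  refine Finset.sum_congr rfl fun i _ => Finset.sum_congr rfl fun j _ => ?_
  rw [← map_smul, Matrix.smul_single, smul_eq_mul, mul_one]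

@[simp]
theorem evalAt_linForm (φ : Matrix (Fin n) (Fin n) ℂ →ₗ[ℂ] ℂ) (M : Matrix (Fin n) (Fin n) ℂ) :
    evalAt M (linForm φ) = φ M := by
  rw [← sum_entries_mul_map_single φ M]
  simp [evalAt, linForm, mul_comm]

theorem isHomogeneous_linForm (φ : Matrix (Fin n) (Fin n) ℂ →ₗ[ℂ] ℂ) :
    (linForm φ).IsHomogeneous 1 := by
  refine MvPolynomial.IsHomogeneous.sum _ _ _ fun ij _ => ?_
  simpa using (MvPolynomial.isHomogeneous_C _ _).mul (MvPolynomial.isHomogeneous_X ℂ ij)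

theorem forGenericSymm_linear_ne_zero (φ : Matrix (Fin n) (Fin n) ℂ →ₗ[ℂ] ℂ)
    (h : ∃ S ∈ symMatrices n, φ S ≠ 0) : ForGenericSymm fun S => φ S ≠ 0 :=
  ⟨linForm φ, by simpa using h, fun S _ hS => by simpa using hS⟩

theorem forGenericSymm_forall_mem {ι : Type*} (E : Finset ι)
    {P : ι → Matrix (Fin n) (Fin n) ℂ → Prop} (h : ∀ i ∈ E, ForGenericSymm (P i)) :
    ForGenericSymm fun S => ∀ i ∈ E, P i S := by
  classical
  induction E using Finset.induction_on with
  | empty => exact ⟨1, ⟨0, zero_mem _, by simp [evalAt]⟩, by simp⟩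
  | insert a s ha ih =>
    refine ((h a (by simp)).and (ih fun i hi => h i (by simp [hi]))).mono fun S _ hS => ?_
    simpa using hS

end Generic

/-! ### Linear systems of polynomials without base points -/

/-- If `f` and `g` have no common root, then for all but finitely many `c` the polynomial `f + c g`
is separable: a multiple root of `f + c g` is a root of the Wronskian of `f` and `g`, which is not
zero, and it determines `c`. -/
theorem finite_not_separable_add_C_mul {f g : ℂ[X]} (hfg : IsCoprime f g) (hf : 0 < f.natDegree) :
    {c : ℂ | ¬ (f + C c * g).Separable}.Finite := by
  -- If the Wronskian vanished, `f` would divide its own derivative.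
  have hW : f * derivative g - derivative f * g ≠ 0 := by
    intro h
    have h1 : f ∣ derivative f * g := ⟨derivative g, (sub_eq_zero.mp h).symm⟩
    have h2 : f ∣ derivative f := hfg.dvd_of_dvd_mul_right h1
    have h3 : derivative f ≠ 0 := fun h0 => hf.ne' (derivative_eq_zero.mp h0)
    have h4 := natDegree_le_of_dvd h2 h3
    have h5 := natDegree_derivative_lt (p := f) hf.ne'
    omega
  refine ((f * derivative g - derivative f * g).roots.toFinset.image
    fun y => - f.eval y / g.eval y).finite_toSet.subset fun c hc => ?_
  obtain ⟨y, hy1, hy2⟩ : ∃ y, (f + C c * g).eval y = 0 ∧ (derivative (f + C c * g)).eval y = 0 := by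
    by_contra! h
    refine hc ((isCoprime_iff_aeval_ne_zero_of_isAlgClosed ℂ ℂ _ _).mpr fun y => ?_)
    simpa [or_iff_not_imp_left] using h y
  simp only [eval_add, eval_mul, eval_C, derivative_add, derivative_C_mul] at hy1 hy2
  have hg : g.eval y ≠ 0 := by
    intro hg
    obtain ⟨a, b, hab⟩ := hfg
    have := congrArg (Polynomial.eval y) hab
    simp only [hg, mul_zero, add_zero] at hy1
    simp [hg, hy1] at this
  simp only [Finset.coe_image, Set.mem_image, Finset.mem_coe, Multiset.mem_toFinset, mem_roots hW]
  refine ⟨y, ?_, ?_⟩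
  · simp only [IsRoot.def, eval_sub, eval_mul]
    linear_combination eval y (derivative g) * hy1 - eval y g * hy2
  · field_simp
    linear_combination - hy1

/-- A linear system of polynomials of degree at most `d`, parametrised by symmetric matrices and
without base points (neither in `ℂ` nor at infinity), has a member that is separable of
degree `d`. -/
theorem exists_separable_of_basePointFree {n : ℕ} (Φ : Matrix (Fin n) (Fin n) ℂ →ₗ[ℂ] ℂ[X])
    {d : ℕ} (hdeg : ∀ S, (Φ S).natDegree ≤ d) (htop : ∃ S ∈ symMatrices n, (Φ S).coeff d ≠ 0)
    (hbase : ∀ y, ∃ S ∈ symMatrices n, (Φ S).eval y ≠ 0) :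
    ∃ S ∈ symMatrices n, (Φ S).natDegree = d ∧ (Φ S).Separable := by
  obtain ⟨S₀, hS₀, htop₀⟩ := htop
  have hd₀ : (Φ S₀).natDegree = d := le_antisymm (hdeg _) (le_natDegree_of_ne_zero htop₀)
  have hne : Φ S₀ ≠ 0 := fun h => htop₀ (by simp [h])
  rcases Nat.eq_zero_or_pos d with rfl | hd
  · refine ⟨S₀, hS₀, hd₀, ?_⟩
    rw [eq_C_of_natDegree_eq_zero hd₀, separable_C]
    simpa using htop₀
  · -- A member that avoids the finitely many roots of `Φ S₀` is coprime to `Φ S₀`.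
    obtain ⟨S₁, hS₁, hroots⟩ := Module.Dual.exists_forall_mem_ne_zero_of_forall_exists
      (symMatrices n) (fun y : {y // y ∈ (Φ S₀).roots.toFinset} => (leval (y : ℂ)).comp Φ)
      fun y => by simpa using hbase y
    have hcop : IsCoprime (Φ S₀) (Φ S₁) := by
      refine (isCoprime_iff_aeval_ne_zero_of_isAlgClosed ℂ ℂ _ _).mpr fun y => ?_
      by_cases hy : (Φ S₀).eval y = 0
      · exact Or.inr (by simpa using hroots ⟨y, by simp [hne, hy]⟩)
      · exact Or.inl (by simpa using hy)
    have hfin := (finite_not_separable_add_C_mul hcop (hd₀ ▸ hd)).union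
      (Set.finite_singleton (-(Φ S₀).coeff d / (Φ S₁).coeff d))
    obtain ⟨c, hc⟩ := (hfin.union (Set.finite_singleton 0)).exists_notMem
    simp only [Set.mem_union, Set.mem_ofPred_eq, not_or, not_not, Set.mem_singleton_iff] at hc
    refine ⟨S₀ + c • S₁, add_mem hS₀ (Submodule.smul_mem _ _ hS₁),
      le_antisymm (hdeg _) (le_natDegree_of_ne_zero ?_), ?_⟩
    · intro h
      simp only [map_add, map_smul, coeff_add, coeff_smul, smul_eq_mul] at h
      by_cases h1 : (Φ S₁).coeff d = 0
      · exact htop₀ (by simpa [h1] using h)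
      · refine hc.1.2 ?_
        field_simp
        linear_combination h
    · simpa [smul_eq_C_mul] using hc.1.1

/-- Bertini's theorem for linear systems on the projective line: the generic member of a linear
system of polynomials of degree at most `d` without base points is separable of degree `d`, and it
does not vanish at finitely many given points. Openness of the condition comes from the resultant
of the member with its derivative, a polynomial in the parameters. -/
theorem forGenericSymm_separable {n : ℕ} (Φ : Matrix (Fin n) (Fin n) ℂ →ₗ[ℂ] ℂ[X])
    {d : ℕ} (hdeg : ∀ S, (Φ S).natDegree ≤ d) (htop : ∃ S ∈ symMatrices n, (Φ S).coeff d ≠ 0)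
    (hbase : ∀ y, ∃ S ∈ symMatrices n, (Φ S).eval y ≠ 0) (E : Finset ℂ) :
    ForGenericSymm fun S => (Φ S).natDegree = d ∧ (Φ S).Separable ∧ ∀ y ∈ E, (Φ S).eval y ≠ 0 := by
  let Ψ : Polynomial (MatrixPoly n) := ∑ ij : Fin n × Fin n,
    C (MvPolynomial.X ij) * (Φ (Matrix.single ij.1 ij.2 1)).map MvPolynomial.C
  have hΨ : ∀ S : Matrix (Fin n) (Fin n) ℂ,
      Ψ.map (MvPolynomial.eval fun ij => S ij.1 ij.2) = Φ S := by
    intro S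
    rw [← sum_entries_mul_map_single Φ S]
    simp only [Ψ, Polynomial.map_sum, Polynomial.map_mul, map_C, MvPolynomial.eval_X,
      Polynomial.map_map, smul_eq_C_mul]
    refine Finset.sum_congr rfl fun ij _ => ?_
    congr 1
    convert Polynomial.map_id
    ext; simp
  have hres : ∀ S, evalAt S (resultant Ψ (derivative Ψ) d (d - 1)) =
      resultant (Φ S) (derivative (Φ S)) d (d - 1) := by
    intro S
    rw [evalAt, ← resultant_map_map, ← derivative_map, hΨ]
  have hsep : ∀ S, (Φ S).coeff d ≠ 0 →
      (resultant (Φ S) (derivative (Φ S)) d (d - 1) ≠ 0 ↔ (Φ S).Separable) := by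
    intro S hS
    have hd : (Φ S).natDegree = d := le_antisymm (hdeg _) (le_natDegree_of_ne_zero hS)
    have hne : Φ S ≠ 0 := fun h => hS (by simp [h])
    have := resultant_eq_zero_iff (f := Φ S) (g := derivative (Φ S))
    rw [natDegree_derivative, hd] at this
    rw [Ne, this]
    simp [hne, Polynomial.Separable]
  have hgen : ForGenericSymm fun S => evalAt S (resultant Ψ (derivative Ψ) d (d - 1)) ≠ 0 := by
    obtain ⟨S, hS, hd, hs⟩ := exists_separable_of_basePointFree Φ hdeg htop hbase
    refine ⟨_, ⟨S, hS, ?_⟩, fun _ _ h => h⟩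
    rw [hres, hsep S]
    · exact hs
    · rw [← hd, coeff_natDegree, leadingCoeff_ne_zero]
      exact hs.ne_zero
  refine ((hgen.and (forGenericSymm_linear_ne_zero ((lcoeff ℂ d).comp Φ) htop)).and
    (forGenericSymm_forall_mem E fun y _ =>
      forGenericSymm_linear_ne_zero ((leval y).comp Φ) (hbase y))).mono fun S _ hS => ?_
  obtain ⟨⟨h1, h2⟩, h3⟩ := hS
  have h2 : (Φ S).coeff d ≠ 0 := h2
  rw [hres, hsep S h2] at h1
  exact ⟨le_antisymm (hdeg _) (le_natDegree_of_ne_zero h2), h1, h3⟩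

theorem encard_roots_of_separable {f : ℂ[X]} (hf : f.Separable) :
    {y : ℂ | f.eval y = 0}.encard = f.natDegree := by
  have h : {y : ℂ | f.eval y = 0} = f.rootSet ℂ := by
    ext y
    simp [mem_rootSet, hf.ne_zero]
  rw [h, ← Set.coe_fintypeCard, card_rootSet_eq_natDegree hf (IsAlgClosed.splits _)]

/-! ### The linear systems attached to a diagonal pencil -/

section Systems

variable {ι : Type*} [Fintype ι] (lam : ι → ℂ)

/-- The distinct values of `lam`. -/
noncomputable def spectrumFinset : Finset ℂ := Finset.univ.image lam

/-- The product of the linear forms `X + μ` over the distinct values `μ` of `lam`. -/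
noncomputable def fullProd : ℂ[X] := ∏ ν ∈ spectrumFinset lam, (X + C ν)

/-- The product of the linear forms `X + ν` over the distinct values `ν ≠ μ` of `lam`. -/
noncomputable def coProd (μ : ℂ) : ℂ[X] := ∏ ν ∈ (spectrumFinset lam).erase μ, (X + C ν)

/-- The product of the linear forms `X + ν` over the distinct values `ν ≠ μ, μ'` of `lam`. -/
noncomputable def coProd₂ (μ μ' : ℂ) : ℂ[X] :=
  ∏ ν ∈ ((spectrumFinset lam).erase μ).erase μ', (X + C ν)

/-- The numerator of the rational function `∑ i, w i / (X + lam i)`. -/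
noncomputable def hyperplaneSystem : (ι → ℂ) →ₗ[ℂ] ℂ[X] :=
  Fintype.linearCombination ℂ fun j => coProd lam (lam j)

/-- The numerator of the rational function `∑ i, (t * lam i - s) / (X + lam i)`, where
`t = ∑ j, w j` and `s = ∑ j, w j * lam j`. -/
noncomputable def mlSystem : (ι → ℂ) →ₗ[ℂ] ℂ[X] :=
  Fintype.linearCombination ℂ fun j => ∑ i, C (lam i - lam j) * coProd lam (lam i)

/-- The numerator of the rational function
`∑ j, ∑ i, w j * (lam j - lam i) / ((X + lam i) * (X + lam j) ^ 2)`. -/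
noncomputable def reciprocalMLSystem : (ι → ℂ) →ₗ[ℂ] ℂ[X] :=
  Fintype.linearCombination ℂ fun j =>
    ∑ i, C (lam j - lam i) * (coProd lam (lam j) * coProd₂ lam (lam i) (lam j))

theorem mem_spectrumFinset (i : ι) : lam i ∈ spectrumFinset lam :=
  Finset.mem_image_of_mem _ (Finset.mem_univ i)

theorem monic_coProd (μ : ℂ) : (coProd lam μ).Monic :=
  monic_prod_of_monic _ _ fun ν _ => monic_X_add_C ν

theorem natDegree_coProd (i : ι) :
    (coProd lam (lam i)).natDegree = (spectrumFinset lam).card - 1 := by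
  rw [coProd, natDegree_prod_of_monic _ _ fun ν _ => monic_X_add_C ν]
  simp [mem_spectrumFinset]

theorem monic_coProd₂ (μ μ' : ℂ) : (coProd₂ lam μ μ').Monic :=
  monic_prod_of_monic _ _ fun ν _ => monic_X_add_C ν

theorem natDegree_coProd₂ {i j : ι} (h : lam i ≠ lam j) :
    (coProd₂ lam (lam i) (lam j)).natDegree = (spectrumFinset lam).card - 2 := by
  rw [coProd₂, natDegree_prod_of_monic _ _ fun ν _ => monic_X_add_C ν]
  simp [mem_spectrumFinset, h.symm, Nat.sub_sub]

theorem X_add_C_mul_coProd (i : ι) : (X + C (lam i)) * coProd lam (lam i) = fullProd lam :=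
  Finset.mul_prod_erase _ (fun ν => X + C ν) (mem_spectrumFinset lam i)

theorem X_add_C_mul_coProd₂ {i j : ι} (h : lam i ≠ lam j) :
    (X + C (lam j)) * coProd₂ lam (lam i) (lam j) = coProd lam (lam i) :=
  Finset.mul_prod_erase _ (fun ν => X + C ν)
    (Finset.mem_erase.mpr ⟨h.symm, mem_spectrumFinset lam j⟩)

theorem eval_coProd_neg_self_ne_zero (μ : ℂ) : (coProd lam μ).eval (-μ) ≠ 0 := by
  rw [coProd, eval_prod, Finset.prod_ne_zero_iff]
  intro ν hν h
  simp only [eval_add, eval_X, eval_C] at h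
  exact (Finset.mem_erase.mp hν).1 (by linear_combination h)

theorem eval_coProd_neg {i : ι} {μ : ℂ} (h : lam i ≠ μ) : (coProd lam μ).eval (-lam i) = 0 := by
  rw [coProd, eval_prod, Finset.prod_eq_zero (Finset.mem_erase.mpr ⟨h, mem_spectrumFinset lam i⟩)]
  simp

section Values

variable {lam} {y : ℂ} (hy : ∀ i, y + lam i ≠ 0)
include hy

theorem eval_fullProd_ne_zero : (fullProd lam).eval y ≠ 0 := by
  rw [fullProd, eval_prod, Finset.prod_ne_zero_iff]
  intro ν hν
  obtain ⟨i, -, rfl⟩ := Finset.mem_image.mp hν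
  simpa using hy i

theorem eval_coProd (i : ι) :
    (coProd lam (lam i)).eval y = (fullProd lam).eval y / (y + lam i) := by
  rw [← X_add_C_mul_coProd lam i]
  field_simp [hy i]
  simp [mul_comm]

theorem eval_mul_coProd₂ (i j : ι) : (lam j - lam i) * (coProd₂ lam (lam i) (lam j)).eval y =
    (lam j - lam i) * ((fullProd lam).eval y / ((y + lam i) * (y + lam j))) := by
  by_cases h : lam i = lam j
  · simp [h]
  · rw [← X_add_C_mul_coProd lam i, ← X_add_C_mul_coProd₂ lam h]
    have := hy i
    have := hy j
    simp only [eval_mul, eval_add, eval_X, eval_C]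
    field_simp

theorem eval_hyperplaneSystem (w : ι → ℂ) :
    (hyperplaneSystem lam w).eval y = (fullProd lam).eval y * ∑ i, w i / (y + lam i) := by
  simp only [hyperplaneSystem, Fintype.linearCombination_apply, eval_finsetSum, eval_smul,
    eval_coProd hy, Finset.mul_sum, smul_eq_mul]
  exact Finset.sum_congr rfl fun i _ => by ring

theorem eval_mlSystem (w : ι → ℂ) :
    (mlSystem lam w).eval y = (fullProd lam).eval y *
      ((∑ j, w j) * ∑ i, lam i / (y + lam i) - (∑ j, w j * lam j) * ∑ i, 1 / (y + lam i)) := by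
  simp only [mlSystem, Fintype.linearCombination_apply, eval_finsetSum, eval_smul,
    eval_coProd hy, Finset.mul_sum, smul_eq_mul, eval_mul, eval_C, Finset.sum_mul,
    ← Finset.sum_sub_distrib]
  rw [Finset.sum_comm]
  exact Finset.sum_congr rfl fun i _ => Finset.sum_congr rfl fun j _ => by ring

theorem eval_reciprocalMLSystem (w : ι → ℂ) :
    (reciprocalMLSystem lam w).eval y = (fullProd lam).eval y ^ 2 *
      ((∑ i, 1 / (y + lam i)) * ∑ j, w j * lam j / (y + lam j) ^ 2 -
        (∑ i, lam i / (y + lam i)) * ∑ j, w j / (y + lam j) ^ 2) := by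
  simp only [reciprocalMLSystem, Fintype.linearCombination_apply, eval_finsetSum, eval_smul,
    Finset.mul_sum, smul_eq_mul, eval_mul, eval_C, Finset.sum_mul, ← Finset.sum_sub_distrib]
  refine Finset.sum_congr rfl fun j _ => Finset.sum_congr rfl fun i _ => ?_
  rw [mul_left_comm (lam j - lam i), eval_mul_coProd₂ hy, eval_coProd hy]
  have := hy i
  have := hy j
  field_simp

/-- The derivative of the numerator of `g = ∑ i, w i / (X + lam i)` is computed by the product
rule from `g' = - ∑ i, w i / (X + lam i) ^ 2`. -/
theorem eval_derivative_hyperplaneSystem (w : ι → ℂ) :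
    (derivative (hyperplaneSystem lam w)).eval y =
      (derivative (fullProd lam)).eval y * ∑ i, w i / (y + lam i) -
        (fullProd lam).eval y * ∑ i, w i / (y + lam i) ^ 2 := by
  have h : ∀ i, (derivative (coProd lam (lam i))).eval y =
      (derivative (fullProd lam)).eval y / (y + lam i) -
        (fullProd lam).eval y / (y + lam i) ^ 2 := by
    intro i
    rw [← X_add_C_mul_coProd lam i]
    have := hy i
    simp only [derivative_mul, derivative_add, derivative_X, derivative_C, add_zero, one_mul,
      eval_add, eval_mul, eval_X, eval_C]
    field_simp
    ring
  simp only [hyperplaneSystem, Fintype.linearCombination_apply, derivative_sum, derivative_smul,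
    eval_finsetSum, eval_smul, h, Finset.mul_sum, smul_eq_mul, ← Finset.sum_sub_distrib]
  exact Finset.sum_congr rfl fun i _ => by ring

end Values

theorem eval_hyperplaneSystem_neg (w : ι → ℂ) (i : ι) :
    (hyperplaneSystem lam w).eval (-lam i) =
      (∑ j, if lam j = lam i then w j else 0) * (coProd lam (lam i)).eval (-lam i) := by
  rw [hyperplaneSystem, Fintype.linearCombination_apply, eval_finsetSum, Finset.sum_mul]
  refine Finset.sum_congr rfl fun j _ => ?_
  split_ifs with h
  · simp [h]
  · simp [eval_coProd_neg lam (Ne.symm h)]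

/-! ### Absence of base points -/

theorem natDegree_hyperplaneSystem_le (w : ι → ℂ) :
    (hyperplaneSystem lam w).natDegree ≤ (spectrumFinset lam).card - 1 := by
  rw [hyperplaneSystem, Fintype.linearCombination_apply]
  refine natDegree_sum_le_of_forall_le _ _ fun i _ => (natDegree_smul_le _ _).trans ?_
  rw [natDegree_coProd]

theorem natDegree_mlSystem_le (w : ι → ℂ) :
    (mlSystem lam w).natDegree ≤ (spectrumFinset lam).card - 1 := by
  rw [mlSystem, Fintype.linearCombination_apply]
  refine natDegree_sum_le_of_forall_le _ _ fun j _ => (natDegree_smul_le _ _).trans ?_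
  refine natDegree_sum_le_of_forall_le _ _ fun i _ => (natDegree_C_mul_le _ _).trans ?_
  rw [natDegree_coProd]

theorem natDegree_coProd_mul_coProd₂ {i j : ι} (h : lam i ≠ lam j) :
    (coProd lam (lam j) * coProd₂ lam (lam i) (lam j)).natDegree =
      2 * (spectrumFinset lam).card - 3 := by
  have : 1 < (spectrumFinset lam).card :=
    Finset.one_lt_card.mpr ⟨_, mem_spectrumFinset lam i, _, mem_spectrumFinset lam j, h⟩
  rw [(monic_coProd _ _).natDegree_mul (monic_coProd₂ _ _ _), natDegree_coProd,
    natDegree_coProd₂ _ h]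
  omega

theorem natDegree_reciprocalMLSystem_le (w : ι → ℂ) :
    (reciprocalMLSystem lam w).natDegree ≤ 2 * (spectrumFinset lam).card - 3 := by
  rw [reciprocalMLSystem, Fintype.linearCombination_apply]
  refine natDegree_sum_le_of_forall_le _ _ fun j _ => (natDegree_smul_le _ _).trans ?_
  refine natDegree_sum_le_of_forall_le _ _ fun i _ => ?_
  by_cases h : lam i = lam j
  · simp [h]
  · exact (natDegree_C_mul_le _ _).trans (natDegree_coProd_mul_coProd₂ _ h).le

theorem coeff_hyperplaneSystem (w : ι → ℂ) :
    (hyperplaneSystem lam w).coeff ((spectrumFinset lam).card - 1) = ∑ i, w i := by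
  rw [hyperplaneSystem, Fintype.linearCombination_apply, finsetSum_coeff]
  refine Finset.sum_congr rfl fun i _ => ?_
  rw [coeff_smul, ← natDegree_coProd lam i, coeff_natDegree, monic_coProd, smul_eq_mul, mul_one]

theorem coeff_mlSystem (w : ι → ℂ) :
    (mlSystem lam w).coeff ((spectrumFinset lam).card - 1) =
      ∑ j, w j * ∑ i, (lam i - lam j) := by
  rw [mlSystem, Fintype.linearCombination_apply, finsetSum_coeff]
  refine Finset.sum_congr rfl fun j _ => ?_
  rw [coeff_smul, finsetSum_coeff, smul_eq_mul]
  congr 1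
  refine Finset.sum_congr rfl fun i _ => ?_
  rw [coeff_C_mul, ← natDegree_coProd lam i, coeff_natDegree, monic_coProd, mul_one]

theorem coeff_reciprocalMLSystem (w : ι → ℂ) :
    (reciprocalMLSystem lam w).coeff (2 * (spectrumFinset lam).card - 3) =
      ∑ j, w j * ∑ i, (lam j - lam i) := by
  rw [reciprocalMLSystem, Fintype.linearCombination_apply, finsetSum_coeff]
  refine Finset.sum_congr rfl fun j _ => ?_
  rw [coeff_smul, finsetSum_coeff, smul_eq_mul]
  congr 1
  refine Finset.sum_congr rfl fun i _ => ?_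
  by_cases h : lam i = lam j
  · simp [h]
  · rw [coeff_C_mul, ← natDegree_coProd_mul_coProd₂ lam h, coeff_natDegree,
      (monic_coProd _ _).mul (monic_coProd₂ _ _ _), mul_one]

theorem exists_coeff_hyperplaneSystem_ne_zero [Nonempty ι] :
    ∃ w, (hyperplaneSystem lam w).coeff ((spectrumFinset lam).card - 1) ≠ 0 := by
  classical
  obtain ⟨i⟩ := ‹Nonempty ι›
  exact ⟨Pi.single i 1, by simp [coeff_hyperplaneSystem]⟩

theorem exists_eval_hyperplaneSystem_ne_zero [Nonempty ι] (y : ℂ) :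
    ∃ w, (hyperplaneSystem lam w).eval y ≠ 0 := by
  classical
  by_cases hy : ∀ i, y + lam i ≠ 0
  · obtain ⟨i⟩ := ‹Nonempty ι›
    refine ⟨Pi.single i 1, ?_⟩
    simp [hyperplaneSystem, eval_coProd hy, eval_fullProd_ne_zero hy, hy]
  · push Not at hy
    obtain ⟨i, hi⟩ := hy
    obtain rfl : y = -lam i := by linear_combination hi
    exact ⟨Pi.single i 1, by
      simpa [hyperplaneSystem] using eval_coProd_neg_self_ne_zero lam (lam i)⟩

variable (hlam : ∃ i j, lam i ≠ lam j)
include hlam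

theorem card_cast_ne_zero : (Fintype.card ι : ℂ) ≠ 0 := by
  obtain ⟨i, -, -⟩ := hlam
  have : Nonempty ι := ⟨i⟩
  exact Nat.cast_ne_zero.mpr Fintype.card_ne_zero

/-- An affine expression in `lam j` with nonzero slope is nonzero for some `j`. -/
theorem exists_mul_add_ne_zero {a : ℂ} (ha : a ≠ 0) (b : ℂ) : ∃ j, a * lam j + b ≠ 0 := by
  obtain ⟨i, j, hij⟩ := hlam
  by_contra! h
  exact hij (mul_left_cancel₀ ha (by linear_combination h i - h j))

theorem exists_coeff_mlSystem_ne_zero :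
    ∃ w, (mlSystem lam w).coeff ((spectrumFinset lam).card - 1) ≠ 0 := by
  classical
  obtain ⟨j, hj⟩ := exists_mul_add_ne_zero lam hlam (card_cast_ne_zero lam hlam) (-∑ i, lam i)
  refine ⟨Pi.single j 1, fun h => hj ?_⟩
  simp [coeff_mlSystem, Finset.sum_sub_distrib, Pi.single_apply] at h
  linear_combination -h

theorem exists_coeff_reciprocalMLSystem_ne_zero :
    ∃ w, (reciprocalMLSystem lam w).coeff (2 * (spectrumFinset lam).card - 3) ≠ 0 := by
  classical
  obtain ⟨j, hj⟩ := exists_mul_add_ne_zero lam hlam (card_cast_ne_zero lam hlam) (-∑ i, lam i)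
  refine ⟨Pi.single j 1, fun h => hj ?_⟩
  simp [coeff_reciprocalMLSystem, Finset.sum_sub_distrib, Pi.single_apply] at h
  linear_combination h

omit hlam in
/-- The identity `∑ i, lam i / (y + lam i) = n - y * ∑ i, 1 / (y + lam i)`. -/
theorem sum_div_add_mul_sum_one_div {y : ℂ} (hy : ∀ i, y + lam i ≠ 0) :
    ∑ i, lam i / (y + lam i) + y * ∑ i, 1 / (y + lam i) = Fintype.card ι := by
  rw [Finset.mul_sum, ← Finset.sum_add_distrib, Fintype.card_eq_sum_ones, Nat.cast_sum]
  refine Finset.sum_congr rfl fun i _ => ?_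
  have := hy i
  field_simp
  simp [add_comm]

/-- Away from the values `-lam i`, no `y` is a root of both
`∑ i, lam i / (y + lam i) - lam j * ∑ i, 1 / (y + lam i)` for all `j`. -/
theorem exists_sum_div_sub_ne_zero {y : ℂ} (hy : ∀ i, y + lam i ≠ 0) :
    ∃ j, ∑ i, lam i / (y + lam i) - lam j * ∑ i, 1 / (y + lam i) ≠ 0 := by
  have hn := card_cast_ne_zero lam hlam
  by_cases ha : ∑ i, 1 / (y + lam i) = 0
  · obtain ⟨j, -, -⟩ := hlam
    refine ⟨j, fun h => hn ?_⟩
    rw [← sum_div_add_mul_sum_one_div lam hy]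
    linear_combination h + (lam j + y) * ha
  · obtain ⟨j, hj⟩ := exists_mul_add_ne_zero lam hlam ha (-∑ i, lam i / (y + lam i))
    exact ⟨j, fun h => hj (by linear_combination -h)⟩

theorem exists_eval_mlSystem_ne_zero (y : ℂ) : ∃ w, (mlSystem lam w).eval y ≠ 0 := by
  classical
  by_cases hy : ∀ i, y + lam i ≠ 0
  · obtain ⟨j, hj⟩ := exists_sum_div_sub_ne_zero lam hlam hy
    refine ⟨Pi.single j 1, ?_⟩
    rw [eval_mlSystem hy]
    refine mul_ne_zero (eval_fullProd_ne_zero hy) ?_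
    simpa [Pi.single_apply] using hj
  · push Not at hy
    obtain ⟨i, hi⟩ := hy
    obtain rfl : y = -lam i := by linear_combination hi
    obtain ⟨j, hj⟩ := exists_mul_add_ne_zero lam hlam one_ne_zero (-lam i)
    have hji : lam i ≠ lam j := fun h => hj (by rw [h]; ring)
    refine ⟨Pi.single j 1, ?_⟩
    have hterm : ∀ k, (C (lam k - lam j) * coProd lam (lam k)).eval (-lam i) =
        if lam k = lam i then (lam i - lam j) * (coProd lam (lam i)).eval (-lam i) else 0 := by
      intro k
      split_ifs with h
      · simp [h]
      · simp [eval_coProd_neg lam (Ne.symm h)]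
    have hcard : ((Finset.univ.filter fun k => lam k = lam i).card : ℂ) ≠ 0 :=
      Nat.cast_ne_zero.mpr (Finset.card_ne_zero.mpr ⟨i, by simp⟩)
    simp only [mlSystem, Fintype.linearCombination_apply_single, one_smul, eval_finsetSum, hterm,
      ← Finset.sum_filter, Finset.sum_const, nsmul_eq_mul]
    exact mul_ne_zero hcard
      (mul_ne_zero (sub_ne_zero.mpr hji) (eval_coProd_neg_self_ne_zero lam (lam i)))

theorem exists_eval_reciprocalMLSystem_ne_zero (y : ℂ) :
    ∃ w, (reciprocalMLSystem lam w).eval y ≠ 0 := by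
  classical
  by_cases hy : ∀ i, y + lam i ≠ 0
  · obtain ⟨j, hj⟩ := exists_sum_div_sub_ne_zero lam hlam hy
    refine ⟨Pi.single j 1, ?_⟩
    rw [eval_reciprocalMLSystem hy]
    refine mul_ne_zero (pow_ne_zero _ (eval_fullProd_ne_zero hy)) fun h => hj ?_
    have hk := hy j
    simp [Pi.single_apply, ite_div] at h ⊢
    field_simp at h
    simp only [one_div] at h
    linear_combination -h
  · push Not at hy
    obtain ⟨j, hj⟩ := hy
    obtain rfl : y = -lam j := by linear_combination hj
    obtain ⟨i, hi⟩ := exists_mul_add_ne_zero lam hlam one_ne_zero (-lam j)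
    have hij : lam i ≠ lam j := fun h => hi (by rw [h]; ring)
    refine ⟨Pi.single j 1, ?_⟩
    have hterm : ∀ k, (C (lam j - lam k) *
        (coProd lam (lam j) * coProd₂ lam (lam k) (lam j))).eval (-lam j) =
        if lam k ≠ lam j then -(coProd lam (lam j)).eval (-lam j) ^ 2 else 0 := by
      intro k
      split_ifs with h
      · have h2 : coProd₂ lam (lam k) (lam j) = coProd₂ lam (lam j) (lam k) := by
          rw [coProd₂, coProd₂, Finset.erase_right_comm]
        have h3 := congrArg (Polynomial.eval (-lam j)) (X_add_C_mul_coProd₂ lam (Ne.symm h))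
        simp only [eval_mul, eval_add, eval_X, eval_C] at h3 ⊢
        rw [h2]
        linear_combination -(coProd lam (lam j)).eval (-lam j) * h3
      · simp [not_not.mp h]
    have hcard : ((Finset.univ.filter fun k => lam k ≠ lam j).card : ℂ) ≠ 0 :=
      Nat.cast_ne_zero.mpr (Finset.card_ne_zero.mpr ⟨i, by simpa using hij⟩)
    simp only [reciprocalMLSystem, Fintype.linearCombination_apply_single, one_smul,
      eval_finsetSum, hterm, ← Finset.sum_filter, Finset.sum_const, nsmul_eq_mul]
    exact mul_ne_zero hcard
      (neg_ne_zero.mpr (pow_ne_zero _ (eval_coProd_neg_self_ne_zero lam (lam j))))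

end Systems

/-! ### Solutions of the likelihood equations of a diagonal pencil -/

section Solutions

variable {ι : Type*} {lam : ι → ℂ}

/-- The vector `k` lies in the diagonal pencil spanned by `lam` and the all-ones vector. -/
def IsAffineIn (lam k : ι → ℂ) : Prop :=
  ∃ x y : ℂ, ∀ i, k i = x * lam i + y

theorem isAffineIn_of_cyclic (hlam : ∃ i j, lam i ≠ lam j) {z : ι → ℂ}
    (hz : ∀ i j k, (lam j - lam k) * z i + (lam k - lam i) * z j + (lam i - lam j) * z k = 0) :
    IsAffineIn lam z := by
  obtain ⟨a, b, hab⟩ := hlam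
  have hab' := sub_ne_zero.mpr hab
  refine ⟨(z a - z b) / (lam a - lam b), (lam a * z b - lam b * z a) / (lam a - lam b),
    fun i => ?_⟩
  field_simp
  linear_combination hz i a b

/-- If every element of `Z` is a multiple `c y * (y + lam i)`, with `c y ≠ 0` determined by a root
`y` of the separable polynomial `f`, then `Z` has as many elements as `f` has roots. -/
theorem encard_eq_natDegree_of_parametrization (hlam : ∃ i j, lam i ≠ lam j) {f : ℂ[X]}
    (hf : f.Separable) {Z : Set (ι → ℂ)} (c : ℂ → ℂ)
    (hZ : ∀ y, f.eval y = 0 → c y ≠ 0 ∧ (fun i => c y * (y + lam i)) ∈ Z)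
    (hZ' : ∀ k ∈ Z, ∃ y, f.eval y = 0 ∧ k = fun i => c y * (y + lam i)) :
    Z.encard = f.natDegree := by
  have himage : Z = (fun y i => c y * (y + lam i)) '' {y | f.eval y = 0} := by
    ext k
    constructor
    · rintro hk
      obtain ⟨y, hy, rfl⟩ := hZ' k hk
      exact ⟨y, hy, rfl⟩
    · rintro ⟨y, hy, rfl⟩
      exact (hZ y hy).2
  rw [himage, Set.InjOn.encard_image, encard_roots_of_separable hf]
  intro y hy y' hy' h
  obtain ⟨i, j, hij⟩ := hlam
  have hi := congrFun h i
  have hj := congrFun h j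
  have hc : c y = c y' := by
    refine mul_right_cancel₀ (sub_ne_zero.mpr hij) ?_
    simp only at hi hj
    linear_combination hi - hj
  simp only [hc] at hi
  exact add_right_cancel (mul_left_cancel₀ (hZ y' hy').1 hi)

variable [Fintype ι]

variable (lam) in
/-- The elements `k` of the diagonal pencil that solve the likelihood equations
`∑ i, 1 / k i = ∑ i, w i` and `∑ i, lam i / k i = ∑ i, w i * lam i`. -/
def mlSolutions (w : ι → ℂ) : Set (ι → ℂ) :=
  {k | IsAffineIn lam k ∧ (∀ i, k i ≠ 0) ∧ ∑ i, 1 / k i = ∑ i, w i ∧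
    ∑ i, lam i / k i = ∑ i, w i * lam i}

variable (lam) in
/-- The elements `k` of the diagonal pencil that solve the likelihood equations
`∑ i, 1 / k i = ∑ i, w i / k i ^ 2` and `∑ i, lam i / k i = ∑ i, w i * lam i / k i ^ 2` of the
reciprocal variety. -/
def reciprocalMLSolutions (w : ι → ℂ) : Set (ι → ℂ) :=
  {k | IsAffineIn lam k ∧ (∀ i, k i ≠ 0) ∧ ∑ i, 1 / k i = ∑ i, w i / k i ^ 2 ∧
    ∑ i, lam i / k i = ∑ i, w i * lam i / k i ^ 2}

theorem sum_mul_sum_sub (w : ι → ℂ) : ∑ j, w j * ∑ i, (lam i - lam j) =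
    (∑ j, w j) * ∑ i, lam i - Fintype.card ι * ∑ j, w j * lam j := by
  rw [Finset.sum_mul, Finset.mul_sum, ← Finset.sum_sub_distrib]
  refine Finset.sum_congr rfl fun j _ => ?_
  rw [Finset.sum_sub_distrib, Finset.sum_const, Finset.card_univ, nsmul_eq_mul]
  ring

theorem sum_div_mul {c : ℂ} (f g : ι → ℂ) : ∑ i, f i / (c * g i) = (∑ i, f i / g i) / c := by
  rw [Finset.sum_div]
  exact Finset.sum_congr rfl fun i _ => by rw [div_div, mul_comm]

theorem sum_div_mul_sq {c : ℂ} (f g : ι → ℂ) :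
    ∑ i, f i / (c * g i) ^ 2 = (∑ i, f i / g i ^ 2) / c ^ 2 := by
  rw [Finset.sum_div]
  exact Finset.sum_congr rfl fun i _ => by rw [div_div, mul_pow, mul_comm]

omit [Fintype ι] in
theorem add_ne_zero_of_eval_neg_ne_zero {f : ℂ[X]} (hE : ∀ i, f.eval (-lam i) ≠ 0) {y : ℂ}
    (hy : f.eval y = 0) (i : ι) : y + lam i ≠ 0 := by
  intro h
  obtain rfl : y = -lam i := by linear_combination h
  exact hE i hy

/-- The likelihood equations are homogeneous of degree `-1` on the left and constant on the right.
Eliminating the scale leaves the polynomial `mlSystem lam w`, and each of its roots determines the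
scale. -/
theorem encard_mlSolutions (hlam : ∃ i j, lam i ≠ lam j) {w : ι → ℂ} (ht : ∑ i, w i ≠ 0)
    (hdeg : (mlSystem lam w).natDegree = (spectrumFinset lam).card - 1)
    (hsep : (mlSystem lam w).Separable) (hE : ∀ i, (mlSystem lam w).eval (-lam i) ≠ 0) :
    (mlSolutions lam w).encard = ((spectrumFinset lam).card - 1 : ℕ) := by
  have hn := card_cast_ne_zero lam hlam
  rw [← hdeg]
  refine encard_eq_natDegree_of_parametrization hlam hsep
    (fun y => (∑ i, 1 / (y + lam i)) / ∑ i, w i) (fun y hy => ?_) ?_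
  · have hk := add_ne_zero_of_eval_neg_ne_zero hE hy
    rw [eval_mlSystem hk] at hy
    have hy := (mul_eq_zero.mp hy).resolve_left (eval_fullProd_ne_zero hk)
    have hid := sum_div_add_mul_sum_one_div lam hk
    have ha : ∑ i, 1 / (y + lam i) ≠ 0 := by
      intro ha
      rw [ha] at hy hid
      have := (mul_eq_zero.mp (by linear_combination hy :
        (∑ i, w i) * ∑ i, lam i / (y + lam i) = 0)).resolve_left ht
      exact hn (by rw [← hid, this]; ring)
    refine ⟨div_ne_zero ha ht, ⟨(∑ i, 1 / (y + lam i)) / ∑ i, w i,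
      (∑ i, 1 / (y + lam i)) / (∑ i, w i) * y, fun i => ?_⟩,
      fun i => mul_ne_zero (div_ne_zero ha ht) (hk i), ?_, ?_⟩
    · ring
    · rw [sum_div_mul]
      generalize (∑ i, 1 / (y + lam i)) = a at *
      field_simp
    · rw [sum_div_mul]
      generalize (∑ i, 1 / (y + lam i)) = a at *
      field_simp
      linear_combination hy
  · rintro k ⟨⟨x, y, hk⟩, hk0, h1, h2⟩
    have hx : x ≠ 0 := by
      -- The point `x = 0` at infinity is no solution, because the leading coefficient is nonzero.
      rintro rfl
      have hlead : (mlSystem lam w).coeff ((spectrumFinset lam).card - 1) ≠ 0 := by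
        rw [← hdeg, coeff_natDegree, leadingCoeff_ne_zero]
        exact hsep.ne_zero
      refine hlead ?_
      have hy : y ≠ 0 := by
        obtain ⟨i, -, -⟩ := hlam
        simpa [hk] using hk0 i
      simp only [hk, zero_mul, zero_add, ← Finset.sum_div] at h1 h2
      simp only [Finset.sum_const, Finset.card_univ, nsmul_eq_mul, mul_one] at h1
      rw [coeff_mlSystem, sum_mul_sum_sub, ← h1, ← h2]
      ring
    have hk' : k = fun i => x * (y / x + lam i) := by
      funext i
      rw [hk]
      field_simp
      ring
    have hy : ∀ i, y / x + lam i ≠ 0 := fun i => by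
      have := hk0 i
      rw [hk'] at this
      exact right_ne_zero_of_mul this
    rw [hk'] at h1 h2
    rw [sum_div_mul] at h1 h2
    refine ⟨y / x, ?_, ?_⟩
    · rw [eval_mlSystem hy, ← h1, ← h2]
      ring
    · have : (∑ i, 1 / (y / x + lam i)) / ∑ i, w i = x := by
        rw [div_eq_iff ht, ← h1]
        field_simp
      rw [this, hk']

theorem sum_div_sq_add_mul {y : ℂ} (w : ι → ℂ) (hy : ∀ i, y + lam i ≠ 0) :
    ∑ i, w i * lam i / (y + lam i) ^ 2 + y * ∑ i, w i / (y + lam i) ^ 2 =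
      ∑ i, w i / (y + lam i) := by
  rw [Finset.mul_sum, ← Finset.sum_add_distrib]
  refine Finset.sum_congr rfl fun i _ => ?_
  have := hy i
  field_simp
  ring

/-- Eliminating the scale from the likelihood equations of the reciprocal variety leaves the
polynomial `reciprocalMLSystem lam w`. The scale `c` at a root `y` is determined by
`n * c = ∑ i, w i / (y + lam i)`; it is not zero, for otherwise `y` would be a double root of
`hyperplaneSystem lam w`. -/
theorem encard_reciprocalMLSolutions (hlam : ∃ i j, lam i ≠ lam j) {w : ι → ℂ}
    (hdeg : (reciprocalMLSystem lam w).natDegree = 2 * (spectrumFinset lam).card - 3)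
    (hsep : (reciprocalMLSystem lam w).Separable)
    (hE : ∀ i, (reciprocalMLSystem lam w).eval (-lam i) ≠ 0)
    (hsep' : (hyperplaneSystem lam w).Separable) :
    (reciprocalMLSolutions lam w).encard = (2 * (spectrumFinset lam).card - 3 : ℕ) := by
  have hn := card_cast_ne_zero lam hlam
  rw [← hdeg]
  refine encard_eq_natDegree_of_parametrization hlam hsep
    (fun y => (∑ i, w i / (y + lam i)) / Fintype.card ι) (fun y hy => ?_) ?_
  · have hk := add_ne_zero_of_eval_neg_ne_zero hE hy
    rw [eval_reciprocalMLSystem hk] at hy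
    have hy := (mul_eq_zero.mp hy).resolve_left (pow_ne_zero _ (eval_fullProd_ne_zero hk))
    have hid := sum_div_add_mul_sum_one_div lam hk
    have hid' := sum_div_sq_add_mul w hk
    have hsimple : ¬ (∑ i, w i / (y + lam i) = 0 ∧ ∑ i, w i / (y + lam i) ^ 2 = 0) := by
      rintro ⟨h0, h1⟩
      have h2 := (isCoprime_iff_aeval_ne_zero_of_isAlgClosed ℂ ℂ _ _).mp hsep' y
      simp [eval_hyperplaneSystem hk, eval_derivative_hyperplaneSystem hk, h0, h1] at h2
    generalize ∑ i, w i / (y + lam i) = g at *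
    generalize hb₁ : ∑ i, w i / (y + lam i) ^ 2 = b₁ at *
    generalize hb₂ : ∑ i, w i * lam i / (y + lam i) ^ 2 = b₂ at *
    generalize ha₁ : ∑ i, 1 / (y + lam i) = a₁ at *
    generalize ha₂ : ∑ i, lam i / (y + lam i) = a₂ at *
    have e1 : g * a₁ = Fintype.card ι * b₁ := by linear_combination hy - a₁ * hid' + b₁ * hid
    have e2 : g * a₂ = Fintype.card ι * b₂ := by
      linear_combination g * hid - y * e1 - Fintype.card ι * hid'
    have hg0 : g ≠ 0 := by
      rintro rfl
      exact hsimple ⟨rfl, (mul_eq_zero.mp (by linear_combination -e1 :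
        (Fintype.card ι : ℂ) * b₁ = 0)).resolve_left hn⟩
    refine ⟨div_ne_zero hg0 hn, ⟨g / Fintype.card ι, g / Fintype.card ι * y, fun i => ?_⟩,
      fun i => mul_ne_zero (div_ne_zero hg0 hn) (hk i), ?_, ?_⟩
    · ring
    · rw [sum_div_mul, sum_div_mul_sq, ha₁, hb₁]
      field_simp
      linear_combination e1
    · rw [sum_div_mul, sum_div_mul_sq, ha₂, hb₂]
      field_simp
      linear_combination e2
  · rintro k ⟨⟨x, y, hk⟩, hk0, h1, h2⟩
    have hx : x ≠ 0 := by
      -- The point `x = 0` at infinity is no solution, because the leading coefficient is nonzero.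
      rintro rfl
      have hlead : (reciprocalMLSystem lam w).coeff (2 * (spectrumFinset lam).card - 3) ≠ 0 := by
        rw [← hdeg, coeff_natDegree, leadingCoeff_ne_zero]
        exact hsep.ne_zero
      refine hlead ?_
      have hy : y ≠ 0 := by
        obtain ⟨i, -, -⟩ := hlam
        simpa [hk] using hk0 i
      simp only [hk, zero_mul, zero_add, ← Finset.sum_div] at h1 h2
      simp only [Finset.sum_const, Finset.card_univ, nsmul_eq_mul, mul_one] at h1
      have hneg : ∑ j, w j * ∑ i, (lam j - lam i) = -∑ j, w j * ∑ i, (lam i - lam j) := by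
        simp only [← Finset.sum_neg_distrib, ← mul_neg, neg_sub]
      rw [coeff_reciprocalMLSystem, hneg, sum_mul_sum_sub]
      field_simp at h1 h2
      rw [← h1, ← h2]
      ring
    have hk' : k = fun i => x * (y / x + lam i) := by
      funext i
      rw [hk]
      field_simp
      ring
    have hy : ∀ i, y / x + lam i ≠ 0 := fun i => by
      have := hk0 i
      rw [hk'] at this
      exact right_ne_zero_of_mul this
    have hid := sum_div_add_mul_sum_one_div lam hy
    have hid' := sum_div_sq_add_mul w hy
    rw [hk'] at h1 h2
    rw [sum_div_mul, sum_div_mul_sq] at h1 h2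
    have e1 : x * ∑ i, 1 / (y / x + lam i) = ∑ i, w i / (y / x + lam i) ^ 2 := by
      rw [div_eq_div_iff hx (pow_ne_zero 2 hx)] at h1
      exact mul_right_cancel₀ hx (by linear_combination h1)
    have e2 : x * ∑ i, lam i / (y / x + lam i) = ∑ i, w i * lam i / (y / x + lam i) ^ 2 := by
      rw [div_eq_div_iff hx (pow_ne_zero 2 hx)] at h2
      exact mul_right_cancel₀ hx (by linear_combination h2)
    refine ⟨y / x, ?_, ?_⟩
    · rw [eval_reciprocalMLSystem hy, ← e1, ← e2]
      ring
    · have : (∑ i, w i / (y / x + lam i)) / Fintype.card ι = x := by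
        rw [div_eq_iff hn]
        linear_combination x * hid - hid' - e2 - y / x * e1
      rw [this, hk']

end Solutions

/-! ### Congruence to diagonal matrices -/

section Congruence

variable {n : ℕ}

/-- The matrix congruent by `A` to the diagonal matrix with diagonal `k`, as a linear function
of `k`. -/
noncomputable def diagCongr (A : Matrix (Fin n) (Fin n) ℂ) :
    (Fin n → ℂ) →ₗ[ℂ] Matrix (Fin n) (Fin n) ℂ where
  toFun k := A * Matrix.diagonal k * A.transpose
  map_add' k l := by
    rw [← Matrix.add_mul, ← Matrix.mul_add, Matrix.diagonal_add]
    rfl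
  map_smul' c k := by simp [Matrix.diagonal_smul]

/-- The diagonal of the matrix `Aᵀ * S * A`, as a linear function of `S`. -/
noncomputable def diagEntries (A : Matrix (Fin n) (Fin n) ℂ) :
    Matrix (Fin n) (Fin n) ℂ →ₗ[ℂ] (Fin n → ℂ) where
  toFun S := (A.transpose * S * A).diag
  map_add' S T := by simp [Matrix.mul_add, Matrix.add_mul]
  map_smul' c S := by simp

variable {A B : Matrix (Fin n) (Fin n) ℂ}

theorem diagCongr_apply (k : Fin n → ℂ) :
    diagCongr A k = A * Matrix.diagonal k * A.transpose := rfl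

theorem diagEntries_apply (S : Matrix (Fin n) (Fin n) ℂ) :
    diagEntries A S = (A.transpose * S * A).diag := rfl

theorem diagCongr_mem_symMatrices (k : Fin n → ℂ) : diagCongr A k ∈ symMatrices n := by
  change (diagCongr A k).transpose = diagCongr A k
  simp [diagCongr_apply, Matrix.mul_assoc]

theorem trace_mul_diagCongr (S : Matrix (Fin n) (Fin n) ℂ) (k : Fin n → ℂ) :
    (S * diagCongr A k).trace = ∑ i, k i * diagEntries A S i := by
  have h : (S * diagCongr A k).trace = (A.transpose * S * A * Matrix.diagonal k).trace := by
    rw [diagCongr_apply, ← Matrix.mul_assoc, Matrix.trace_mul_comm]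
    simp only [Matrix.mul_assoc]
  rw [h]
  simp [Matrix.trace, Matrix.mul_diagonal, diagEntries_apply, mul_comm]

theorem diagCongr_entry (k : Fin n → ℂ) (a b : Fin n) :
    diagCongr A k a b = ∑ l, A a l * k l * A b l := by
  rw [diagCongr_apply, Matrix.mul_apply]
  simp [Matrix.mul_diagonal]

theorem det_diagCongr (k : Fin n → ℂ) : (diagCongr A k).det = A.det ^ 2 * ∏ i, k i := by
  rw [diagCongr_apply, Matrix.det_mul, Matrix.det_mul, Matrix.det_transpose, Matrix.det_diagonal]
  ring

theorem det_ne_zero_of_mul_eq_one (hAB : A * B = 1) : A.det ≠ 0 := by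
  intro h
  have := congrArg Matrix.det hAB
  simp [h] at this

theorem det_diagCongr_ne_zero_iff (hAB : A * B = 1) {k : Fin n → ℂ} :
    (diagCongr A k).det ≠ 0 ↔ ∀ i, k i ≠ 0 := by
  simp [det_diagCongr, det_ne_zero_of_mul_eq_one hAB, Finset.prod_eq_zero_iff]

theorem mul_diagCongr_mul (hAB : A * B = 1) (k : Fin n → ℂ) :
    B * diagCongr A k * B.transpose = Matrix.diagonal k := by
  have h1 : B * A = 1 := mul_eq_one_comm.mp hAB
  have h2 : A.transpose * B.transpose = 1 := by
    rw [← Matrix.transpose_mul, h1, Matrix.transpose_one]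
  calc B * (A * Matrix.diagonal k * A.transpose) * B.transpose
      = (B * A) * Matrix.diagonal k * (A.transpose * B.transpose) := by
        simp only [Matrix.mul_assoc]
    _ = Matrix.diagonal k := by rw [h1, h2, Matrix.one_mul, Matrix.mul_one]

theorem eq_diagCongr_of_mul_mul (hAB : A * B = 1) {M : Matrix (Fin n) (Fin n) ℂ} {k : Fin n → ℂ}
    (h : B * M * B.transpose = Matrix.diagonal k) : M = diagCongr A k := by
  have h2 : B.transpose * A.transpose = 1 := by
    rw [← Matrix.transpose_mul, hAB, Matrix.transpose_one]
  calc M = (A * B) * M * (B.transpose * A.transpose) := by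
        rw [hAB, h2, Matrix.one_mul, Matrix.mul_one]
    _ = A * (B * M * B.transpose) * A.transpose := by simp only [Matrix.mul_assoc]
    _ = diagCongr A k := by rw [h, diagCongr_apply]

theorem diagCongr_injective (hAB : A * B = 1) : Function.Injective (diagCongr A) := by
  intro k l h
  apply Matrix.diagonal_injective
  rw [← mul_diagCongr_mul hAB k, h, mul_diagCongr_mul hAB l]

theorem exists_diagEntries_eq (hAB : A * B = 1) (w : Fin n → ℂ) :
    ∃ S ∈ symMatrices n, diagEntries A S = w := by
  refine ⟨diagCongr B.transpose w, diagCongr_mem_symMatrices w, ?_⟩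
  have h : B.transpose * A.transpose = 1 := by
    rw [← Matrix.transpose_mul, hAB, Matrix.transpose_one]
  have := mul_diagCongr_mul h w
  rw [Matrix.transpose_transpose] at this
  rw [diagEntries_apply, this, Matrix.diag_diagonal]

theorem inv_diagCongr (hAB : A * B = 1) {k : Fin n → ℂ} (hk : ∀ i, k i ≠ 0) :
    (diagCongr A k)⁻¹ = diagCongr B.transpose k⁻¹ := by
  refine Matrix.inv_eq_right_inv ?_
  have h2 : A.transpose * B.transpose = 1 := by
    rw [← Matrix.transpose_mul, mul_eq_one_comm.mp hAB, Matrix.transpose_one]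
  have h3 : Matrix.diagonal k * Matrix.diagonal k⁻¹ = 1 := by
    rw [Matrix.diagonal_mul_diagonal, ← Matrix.diagonal_one]
    congr 1
    funext i
    simp [hk i]
  calc A * Matrix.diagonal k * A.transpose *
        (B.transpose * Matrix.diagonal k⁻¹ * B.transpose.transpose)
      = A * (Matrix.diagonal k * ((A.transpose * B.transpose) * Matrix.diagonal k⁻¹)) * B := by
        simp only [Matrix.mul_assoc, Matrix.transpose_transpose]
    _ = 1 := by rw [h2, Matrix.one_mul, h3, Matrix.mul_one, hAB]

/-- The differential of the log-likelihood function in simultaneous diagonal coordinates. -/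
theorem dLogLikelihood_diagCongr (hAB : A * B = 1) (S : Matrix (Fin n) (Fin n) ℂ)
    {k : Fin n → ℂ} (hk : ∀ i, k i ≠ 0) (h : Fin n → ℂ) :
    dLogLikelihood S (diagCongr A k) (diagCongr A h) =
      ∑ i, h i / k i - ∑ i, h i * diagEntries A S i := by
  have hline : ∀ t : ℂ, diagCongr A k + t • diagCongr A h = diagCongr A (k + t • h) := by
    intro t
    rw [map_add, map_smul]
  have hder : ∀ a b : ℂ, HasDerivAt (fun t : ℂ => b + t * a) a 0 := fun a b => by
    simpa using ((hasDerivAt_id (0 : ℂ)).mul_const a).const_add b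
  have hdet : HasDerivAt (fun t : ℂ => ∏ i, (k i + t * h i))
      (∑ i, (∏ j ∈ Finset.univ.erase i, k j) * h i) 0 := by
    have := HasDerivAt.fun_finsetProd (u := Finset.univ) (x := (0 : ℂ))
      (f := fun i t => k i + t * h i) (f' := fun i => h i) fun i _ => hder (h i) (k i)
    simpa using this
  have hdet' : logDeriv (fun t : ℂ => (diagCongr A k + t • diagCongr A h).det) 0 =
      ∑ i, h i / k i := by
    simp only [hline, det_diagCongr, Pi.add_apply, Pi.smul_apply, smul_eq_mul]
    rw [logDeriv_const_mul _ _ (pow_ne_zero 2 (det_ne_zero_of_mul_eq_one hAB)),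
      logDeriv_apply, hdet.deriv, Finset.sum_div]
    refine Finset.sum_congr rfl fun i _ => ?_
    simp only [zero_mul, add_zero]
    rw [← Finset.mul_prod_erase _ _ (Finset.mem_univ i)]
    have h1 : ∏ j ∈ Finset.univ.erase i, k j ≠ 0 := Finset.prod_ne_zero_iff.mpr fun j _ => hk j
    have h2 := hk i
    field_simp
  have htr : deriv (fun t : ℂ => (S * (diagCongr A k + t • diagCongr A h)).trace) 0 =
      ∑ i, h i * diagEntries A S i := by
    have : (fun t : ℂ => (S * (diagCongr A k + t • diagCongr A h)).trace) =
        fun t => ∑ i, k i * diagEntries A S i + t * ∑ i, h i * diagEntries A S i := by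
      funext t
      rw [Matrix.mul_add, Matrix.trace_add, Matrix.mul_smul, Matrix.trace_smul,
        trace_mul_diagCongr, trace_mul_diagCongr, smul_eq_mul]
    rw [this]
    exact (hder _ _).deriv
  rw [dLogLikelihood, hdet', htr]

end Congruence

/-! ### Tangent spaces -/

section Tangent

variable {n : ℕ}

theorem hasDerivAt_evalAt {γ : ℂ → Matrix (Fin n) (Fin n) ℂ} {T : Matrix (Fin n) (Fin n) ℂ}
    {z : ℂ} (hγ : ∀ i j, HasDerivAt (fun t => γ t i j) (T i j) z) (F : MatrixPoly n) :
    HasDerivAt (fun t => evalAt (γ t) F)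
      (∑ i, ∑ j, T i j * evalAt (γ z) (MvPolynomial.pderiv (i, j) F)) z := by
  induction F using MvPolynomial.induction_on with
  | C a => simpa [evalAt] using hasDerivAt_const z a
  | add F G hF hG =>
    have e : (fun t => evalAt (γ t) (F + G)) = fun t => evalAt (γ t) F + evalAt (γ t) G := by
      funext t
      simp [evalAt]
    rw [e]
    refine (hF.fun_add hG).congr_deriv ?_
    simp [evalAt, mul_add, Finset.sum_add_distrib]
  | mul_X F ij hF =>
    have h := hF.fun_mul (hγ ij.1 ij.2)
    have h1 : ∀ i j, evalAt (γ z) (MvPolynomial.pderiv (i, j) (F * MvPolynomial.X ij)) =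
        evalAt (γ z) (MvPolynomial.pderiv (i, j) F) * γ z ij.1 ij.2 +
          if (i, j) = ij then evalAt (γ z) F else 0 := by
      intro i j
      rw [Derivation.leibniz]
      by_cases hij : (i, j) = ij
      · subst hij
        simp [evalAt]
        ring
      · simp [evalAt, hij, MvPolynomial.pderiv_X_of_ne (Ne.symm hij)]
        ring
    have e : (fun t => evalAt (γ t) (F * MvPolynomial.X ij)) =
        fun t => evalAt (γ t) F * γ t ij.1 ij.2 := by
      funext t
      simp [evalAt]
    rw [e]
    refine h.congr_deriv ?_
    simp only [h1, mul_add, Finset.sum_add_distrib, Finset.sum_mul, mul_assoc]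
    congr 1
    rw [← Fintype.sum_prod_type' fun i j => T i j * if (i, j) = ij then evalAt (γ z) F else 0]
    simp [mul_comm]

/-- The velocity of a curve that stays in `X` near `0` is a tangent vector. -/
theorem mem_tangentSpace_of_curve {X : Set (Matrix (Fin n) (Fin n) ℂ)}
    {γ : ℂ → Matrix (Fin n) (Fin n) ℂ} {T : Matrix (Fin n) (Fin n) ℂ}
    (hγ : ∀ i j, HasDerivAt (fun t => γ t i j) (T i j) 0) (hX : ∀ᶠ t in nhds 0, γ t ∈ X) :
    T ∈ tangentSpace X (γ 0) := by
  intro F hF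
  have h0 : (fun t => evalAt (γ t) F) =ᶠ[nhds 0] fun _ => 0 := hX.mono fun t ht => hF _ ht
  exact (hasDerivAt_evalAt hγ F).unique
    ((hasDerivAt_const (0 : ℂ) (0 : ℂ)).congr_of_eventuallyEq h0)

theorem sum_mul_evalAt_pderiv_linForm (φ : Matrix (Fin n) (Fin n) ℂ →ₗ[ℂ] ℂ)
    (M T : Matrix (Fin n) (Fin n) ℂ) :
    ∑ i, ∑ j, T i j * evalAt M (MvPolynomial.pderiv (i, j) (linForm φ)) = φ T := by
  have hγ : ∀ i j, HasDerivAt (fun t : ℂ => (M + t • T) i j) (T i j) 0 := fun i j => by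
    simpa using ((hasDerivAt_id (0 : ℂ)).mul_const (T i j)).const_add (M i j)
  have h := hasDerivAt_evalAt hγ (linForm φ)
  simp only [evalAt_linForm, zero_smul, add_zero, map_add, map_smul, smul_eq_mul] at h
  refine h.unique ?_
  simpa using ((hasDerivAt_id (0 : ℂ)).mul_const (φ T)).const_add (φ M)

theorem sum_mul_evalAt_pderiv_mul (F G : MatrixPoly n) (M T : Matrix (Fin n) (Fin n) ℂ) :
    ∑ i, ∑ j, T i j * evalAt M (MvPolynomial.pderiv (i, j) (F * G)) =
      (∑ i, ∑ j, T i j * evalAt M (MvPolynomial.pderiv (i, j) F)) * evalAt M G +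
      evalAt M F * ∑ i, ∑ j, T i j * evalAt M (MvPolynomial.pderiv (i, j) G) := by
  simp only [Finset.sum_mul, Finset.mul_sum, ← Finset.sum_add_distrib]
  refine Finset.sum_congr rfl fun i _ => Finset.sum_congr rfl fun j _ => ?_
  rw [Derivation.leibniz]
  simp [evalAt]
  ring

theorem tangentSpace_submodule (L : Submodule ℂ (Matrix (Fin n) (Fin n) ℂ))
    {M : Matrix (Fin n) (Fin n) ℂ} (hM : M ∈ L) :
    tangentSpace (L : Set (Matrix (Fin n) (Fin n) ℂ)) M = L := by
  ext T
  constructor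
  · intro hT
    by_contra hTL
    obtain ⟨φ, hφT, hφL⟩ := Submodule.exists_dual_map_eq_bot_of_notMem (p := L) hTL inferInstance
    refine hφT ?_
    rw [← sum_mul_evalAt_pderiv_linForm φ M T]
    refine hT _ fun N hN => ?_
    rw [evalAt_linForm]
    have : φ N ∈ L.map φ := Submodule.mem_map_of_mem hN
    simpa [hφL] using this
  · intro hT
    have := mem_tangentSpace_of_curve (X := (L : Set (Matrix (Fin n) (Fin n) ℂ)))
      (γ := fun t => M + t • T) (T := T)
      (fun i j => by
        simpa using ((hasDerivAt_id (0 : ℂ)).mul_const (T i j)).const_add (M i j))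
      (Filter.Eventually.of_forall fun t => L.add_mem hM (L.smul_mem t hT))
    simpa using this

end Tangent

/-! ### The reciprocal variety of a diagonal pencil -/

section DiagonalPencil

variable {n : ℕ}

/-- The pencil spanned by `Q * diagonal lam * Qᵀ` and `Q * Qᵀ`. -/
noncomputable def diagPencil (Q : Matrix (Fin n) (Fin n) ℂ) (lam : Fin n → ℂ) :
    Submodule ℂ (Matrix (Fin n) (Fin n) ℂ) :=
  Submodule.span ℂ {diagCongr Q lam, diagCongr Q 1}

variable {Q P : Matrix (Fin n) (Fin n) ℂ} {lam : Fin n → ℂ}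

theorem mem_diagPencil {M : Matrix (Fin n) (Fin n) ℂ} :
    M ∈ diagPencil Q lam ↔ ∃ k, IsAffineIn lam k ∧ M = diagCongr Q k := by
  rw [diagPencil, Submodule.mem_span_pair]
  constructor
  · rintro ⟨x, y, rfl⟩
    exact ⟨x • lam + y • 1, ⟨x, y, fun i => by simp⟩, by simp⟩
  · rintro ⟨k, ⟨x, y, hk⟩, rfl⟩
    refine ⟨x, y, ?_⟩
    rw [← map_smul, ← map_smul, ← map_add]
    congr 1
    funext i
    simp [hk]

theorem transpose_mul_transpose_eq_one (hQP : Q * P = 1) : P.transpose * Q.transpose = 1 := by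
  rw [← Matrix.transpose_mul, hQP, Matrix.transpose_one]

theorem mem_inverses_diagPencil (hQP : Q * P = 1) {N : Matrix (Fin n) (Fin n) ℂ} :
    N ∈ inverses (diagPencil Q lam) ↔
      ∃ k, IsAffineIn lam k ∧ (∀ i, k i ≠ 0) ∧ N = diagCongr P.transpose k⁻¹ := by
  constructor
  · rintro ⟨M, hM, hdet, rfl⟩
    obtain ⟨k, hk, rfl⟩ := mem_diagPencil.mp hM
    have hk0 := (det_diagCongr_ne_zero_iff hQP).mp hdet
    exact ⟨k, hk, hk0, inv_diagCongr hQP hk0⟩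
  · rintro ⟨k, hk, hk0, rfl⟩
    exact ⟨diagCongr Q k, mem_diagPencil.mpr ⟨k, hk, rfl⟩,
      (det_diagCongr_ne_zero_iff hQP).mpr hk0, (inv_diagCongr hQP hk0).symm⟩

/-- The entry `(i, j)` of `Qᵀ * M * Q`, as a linear form in `M`. -/
noncomputable def entryForm (Q : Matrix (Fin n) (Fin n) ℂ) (i j : Fin n) :
    Matrix (Fin n) (Fin n) ℂ →ₗ[ℂ] ℂ where
  toFun M := (Q.transpose * M * Q) i j
  map_add' M N := by simp [Matrix.mul_add, Matrix.add_mul]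
  map_smul' c M := by simp

theorem entryForm_diagCongr (hQP : Q * P = 1) (u : Fin n → ℂ) (i j : Fin n) :
    entryForm Q i j (diagCongr P.transpose u) = Matrix.diagonal u i j := by
  have := mul_diagCongr_mul (transpose_mul_transpose_eq_one hQP) u
  rw [Matrix.transpose_transpose] at this
  exact congrFun (congrFun this i) j

theorem eq_diagCongr_of_entryForm (hQP : Q * P = 1) {M : Matrix (Fin n) (Fin n) ℂ}
    (h : ∀ i j, i ≠ j → entryForm Q i j M = 0) :
    M = diagCongr P.transpose fun i => entryForm Q i i M := by
  refine eq_diagCongr_of_mul_mul (transpose_mul_transpose_eq_one hQP) ?_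
  rw [Matrix.transpose_transpose]
  ext i j
  by_cases hij : i = j
  · subst hij
    rw [Matrix.diagonal_apply_eq]
    rfl
  · rw [Matrix.diagonal_apply_ne _ hij]
    exact h i j hij

/-- The quadric expressing that the reciprocals of the diagonal coordinates `i`, `j`, `k` are
values of one affine function at `lam i`, `lam j`, `lam k`. -/
noncomputable def reciprocalQuadric (Q : Matrix (Fin n) (Fin n) ℂ) (lam : Fin n → ℂ)
    (i j k : Fin n) : MatrixPoly n :=
  linForm ((lam j - lam k) • entryForm Q j j) * linForm (entryForm Q k k) +
    (linForm ((lam k - lam i) • entryForm Q i i) * linForm (entryForm Q k k) +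
      linForm ((lam i - lam j) • entryForm Q i i) * linForm (entryForm Q j j))

theorem isHomogeneous_reciprocalQuadric (i j k : Fin n) :
    (reciprocalQuadric Q lam i j k).IsHomogeneous 2 :=
  ((isHomogeneous_linForm _).mul (isHomogeneous_linForm _)).add
    (((isHomogeneous_linForm _).mul (isHomogeneous_linForm _)).add
      ((isHomogeneous_linForm _).mul (isHomogeneous_linForm _)))

theorem evalAt_reciprocalQuadric (M : Matrix (Fin n) (Fin n) ℂ) (i j k : Fin n) :
    evalAt M (reciprocalQuadric Q lam i j k) =
      (lam j - lam k) * (entryForm Q j j M * entryForm Q k k M) +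
        (lam k - lam i) * (entryForm Q i i M * entryForm Q k k M) +
        (lam i - lam j) * (entryForm Q i i M * entryForm Q j j M) := by
  have h : ∀ F G : MatrixPoly n, evalAt M (F + G) = evalAt M F + evalAt M G := fun F G => by
    simp [evalAt]
  have h' : ∀ F G : MatrixPoly n, evalAt M (F * G) = evalAt M F * evalAt M G := fun F G => by
    simp [evalAt]
  simp only [reciprocalQuadric, h, h', evalAt_linForm, LinearMap.smul_apply, smul_eq_mul]
  ring

theorem sum_mul_evalAt_pderiv_reciprocalQuadric (M T : Matrix (Fin n) (Fin n) ℂ)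
    (i j k : Fin n) :
    ∑ a, ∑ b, T a b * evalAt M (MvPolynomial.pderiv (a, b) (reciprocalQuadric Q lam i j k)) =
      (lam j - lam k) * (entryForm Q j j T * entryForm Q k k M +
          entryForm Q j j M * entryForm Q k k T) +
        (lam k - lam i) * (entryForm Q i i T * entryForm Q k k M +
          entryForm Q i i M * entryForm Q k k T) +
        (lam i - lam j) * (entryForm Q i i T * entryForm Q j j M +
          entryForm Q i i M * entryForm Q j j T) := by
  have h : ∀ F G : MatrixPoly n,
      ∑ a, ∑ b, T a b * evalAt M (MvPolynomial.pderiv (a, b) (F + G)) =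
        ∑ a, ∑ b, T a b * evalAt M (MvPolynomial.pderiv (a, b) F) +
        ∑ a, ∑ b, T a b * evalAt M (MvPolynomial.pderiv (a, b) G) := fun F G => by
    simp [evalAt, mul_add, Finset.sum_add_distrib]
  simp only [reciprocalQuadric, h, sum_mul_evalAt_pderiv_mul, sum_mul_evalAt_pderiv_linForm,
    evalAt_linForm, LinearMap.smul_apply, smul_eq_mul]
  ring

section Vanishing

variable (hQP : Q * P = 1) {N : Matrix (Fin n) (Fin n) ℂ} (hN : N ∈ inverses (diagPencil Q lam))
include hQP hN

theorem entryForm_eq_zero_of_mem_inverses {i j : Fin n} (hij : i ≠ j) :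
    entryForm Q i j N = 0 := by
  obtain ⟨k, -, -, rfl⟩ := (mem_inverses_diagPencil hQP).mp hN
  rw [entryForm_diagCongr hQP, Matrix.diagonal_apply_ne _ hij]

theorem entryForm_sub_eq_zero_of_mem_inverses {i j : Fin n} (hij : lam i = lam j) :
    (entryForm Q i i - entryForm Q j j) N = 0 := by
  obtain ⟨k, ⟨x, y, hk⟩, -, rfl⟩ := (mem_inverses_diagPencil hQP).mp hN
  simp [entryForm_diagCongr hQP, hk, hij]

theorem evalAt_reciprocalQuadric_of_mem_inverses (i j k : Fin n) :
    evalAt N (reciprocalQuadric Q lam i j k) = 0 := by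
  obtain ⟨κ, ⟨x, y, hκ⟩, hκ0, rfl⟩ := (mem_inverses_diagPencil hQP).mp hN
  have hi := hκ0 i
  have hj := hκ0 j
  have hk := hκ0 k
  simp only [evalAt_reciprocalQuadric, entryForm_diagCongr hQP, Matrix.diagonal_apply_eq,
    Pi.inv_apply]
  field_simp
  rw [hκ, hκ, hκ]
  ring

end Vanishing

/-- The common zeros of the equations of the reciprocal variety are the inverses of the invertible
elements of the pencil and the matrices supported on a single eigenvalue. -/
theorem mem_inverses_or_single (hQP : Q * P = 1) (hlam : ∃ i j, lam i ≠ lam j)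
    {M : Matrix (Fin n) (Fin n) ℂ} (h1 : ∀ i j, i ≠ j → entryForm Q i j M = 0)
    (h2 : ∀ i j, lam i = lam j → (entryForm Q i i - entryForm Q j j) M = 0)
    (h3 : ∀ i j k, evalAt M (reciprocalQuadric Q lam i j k) = 0) :
    M ∈ inverses (diagPencil Q lam) ∨
      ∃ (i₀ : Fin n) (c : ℂ),
        M = diagCongr P.transpose fun i => if lam i = lam i₀ then c else 0 := by
  have hM := eq_diagCongr_of_entryForm hQP h1
  simp only [evalAt_reciprocalQuadric] at h3
  simp only [LinearMap.sub_apply, sub_eq_zero] at h2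
  generalize (fun i => entryForm Q i i M) = u at hM
  have hu : ∀ i, entryForm Q i i M = u i := fun i => by
    rw [hM, entryForm_diagCongr hQP, Matrix.diagonal_apply_eq]
  simp only [hu] at h2 h3
  by_cases h0 : ∀ i, u i ≠ 0
  · refine Or.inl ((mem_inverses_diagPencil hQP).mpr
      ⟨u⁻¹, isAffineIn_of_cyclic hlam fun i j k => ?_, fun i => inv_ne_zero (h0 i), ?_⟩)
    · have hi := h0 i
      have hj := h0 j
      have hk := h0 k
      simp only [Pi.inv_apply]
      field_simp
      linear_combination h3 i j k
    · rw [inv_inv, ← hM]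
  · refine Or.inr ?_
    push Not at h0
    obtain ⟨a, ha⟩ := h0
    by_cases hb : ∃ b, u b ≠ 0
    · obtain ⟨b, hb⟩ := hb
      have hab : lam a ≠ lam b := fun h => hb (by rw [← h2 a b h, ha])
      refine ⟨b, u b, ?_⟩
      rw [hM]
      congr 1
      funext i
      split_ifs with hi
      · exact h2 i b hi
      · have := h3 a b i
        rw [ha] at this
        have h4 : (lam b - lam i) * (u b * u i) = 0 := by linear_combination this
        exact (mul_eq_zero.mp ((mul_eq_zero.mp h4).resolve_left
          (sub_ne_zero.mpr (Ne.symm hi)))).resolve_left hb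
    · push Not at hb
      refine ⟨a, 0, ?_⟩
      rw [hM]
      congr 1
      funext i
      simp [hb]

theorem subset_zariskiClosure (X : Set (Matrix (Fin n) (Fin n) ℂ)) : X ⊆ zariskiClosure X :=
  fun M hM _ hF => hF M hM

theorem tangentSpace_zariskiClosure (X : Set (Matrix (Fin n) (Fin n) ℂ))
    (M : Matrix (Fin n) (Fin n) ℂ) : tangentSpace (zariskiClosure X) M = tangentSpace X M := by
  ext T
  constructor
  · intro hT F hF
    exact hT F fun N hN => hN F hF
  · intro hT F hF
    exact hT F fun N hN => hF N (subset_zariskiClosure X hN)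

/-- Taking the Zariski closure adds no invertible matrices to the inverses of a pencil. -/
theorem mem_reciprocalVariety_iff (hQP : Q * P = 1) (hlam : ∃ i j, lam i ≠ lam j)
    {M : Matrix (Fin n) (Fin n) ℂ} (hdet : M.det ≠ 0) :
    M ∈ reciprocalVariety (diagPencil Q lam) ↔ M ∈ inverses (diagPencil Q lam) := by
  refine ⟨fun hM => ?_, fun hM => subset_zariskiClosure _ hM⟩
  rcases mem_inverses_or_single hQP hlam
    (fun i j hij => by
      rw [← evalAt_linForm]
      exact hM _ fun N hN => by
        rw [evalAt_linForm]; exact entryForm_eq_zero_of_mem_inverses hQP hN hij)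
    (fun i j hij => by
      rw [← evalAt_linForm]
      exact hM _ fun N hN => by
        rw [evalAt_linForm]; exact entryForm_sub_eq_zero_of_mem_inverses hQP hN hij)
    (fun i j k => hM _ fun N hN => evalAt_reciprocalQuadric_of_mem_inverses hQP hN i j k)
    with h | ⟨i₀, c, rfl⟩
  · exact h
  · obtain ⟨i, j, hij⟩ := hlam
    have h := (det_diagCongr_ne_zero_iff (transpose_mul_transpose_eq_one hQP)).mp hdet
    have hi := (ite_ne_right_iff.mp (h i)).1
    have hj := (ite_ne_right_iff.mp (h j)).1
    exact absurd (hi.trans hj.symm) hij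

/-- The tangent space of the reciprocal variety at the inverse of an element `k` of the diagonal
pencil. One inclusion comes from the curves `t ↦ (k - t h)⁻¹`, the other from the differentials of
the equations. -/
theorem mem_tangentSpace_reciprocalVariety (hQP : Q * P = 1) (hlam : ∃ i j, lam i ≠ lam j)
    {k : Fin n → ℂ} (hk : IsAffineIn lam k) (hk0 : ∀ i, k i ≠ 0)
    {T : Matrix (Fin n) (Fin n) ℂ} :
    T ∈ tangentSpace (reciprocalVariety (diagPencil Q lam)) (diagCongr P.transpose k⁻¹) ↔
      ∃ h, IsAffineIn lam h ∧ T = diagCongr P.transpose fun i => h i / k i ^ 2 := by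
  rw [reciprocalVariety, tangentSpace_zariskiClosure]
  constructor
  · intro hT
    have h1 : ∀ i j, i ≠ j → entryForm Q i j T = 0 := fun i j hij => by
      rw [← sum_mul_evalAt_pderiv_linForm _ (diagCongr P.transpose k⁻¹)]
      exact hT _ fun N hN => by
        rw [evalAt_linForm]; exact entryForm_eq_zero_of_mem_inverses hQP hN hij
    refine ⟨fun i => entryForm Q i i T * k i ^ 2, isAffineIn_of_cyclic hlam fun a b c => ?_, ?_⟩
    · have h3 := hT _ fun N hN => evalAt_reciprocalQuadric_of_mem_inverses hQP hN a b c
      simp only [sum_mul_evalAt_pderiv_reciprocalQuadric, entryForm_diagCongr hQP,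
        Matrix.diagonal_apply_eq, Pi.inv_apply] at h3
      obtain ⟨x, y, hk⟩ := hk
      have ha := hk0 a
      have hb := hk0 b
      have hc := hk0 c
      -- The cyclic relation for `k` turns the differential of the quadric at `1 / k` into a
      -- multiple of the cyclic relation for the diagonal coordinates of `T` multiplied by `k ^ 2`.
      have hlin : (lam b - lam c) * k a + (lam c - lam a) * k b + (lam a - lam b) * k c = 0 := by
        rw [hk, hk, hk]
        ring
      field_simp at h3
      generalize entryForm Q a a T = va at *
      generalize entryForm Q b b T = vb at *
      generalize entryForm Q c c T = vc at *
      linear_combination (va * k a + vb * k b + vc * k c) * hlin - h3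
    · convert eq_diagCongr_of_entryForm hQP h1 using 2
      funext i
      have := hk0 i
      field_simp
  · rintro ⟨h, ⟨a, b, hh⟩, rfl⟩
    obtain ⟨x, y, hk⟩ := hk
    have hcurve := mem_tangentSpace_of_curve (X := inverses (diagPencil Q lam))
      (γ := fun t => diagCongr P.transpose (k - t • h)⁻¹)
      (T := diagCongr P.transpose fun i => h i / k i ^ 2) ?_ ?_
    · simpa using hcurve
    · intro i j
      simp only [diagCongr_entry]
      refine HasDerivAt.fun_sum fun l _ => ?_
      refine HasDerivAt.mul_const (HasDerivAt.const_mul _ ?_) _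
      have hd : HasDerivAt (fun t : ℂ => k l - t * h l) (-h l) 0 := by
        simpa using ((hasDerivAt_id (0 : ℂ)).mul_const (h l)).const_sub (k l)
      have := hd.fun_inv (by simpa using hk0 l)
      simpa using this
    · have hev : ∀ᶠ t : ℂ in nhds 0, ∀ i, k i - t * h i ≠ 0 := by
        rw [Filter.eventually_all]
        intro i
        have hcont : Continuous fun t : ℂ => k i - t * h i := by fun_prop
        exact hcont.continuousAt.eventually_ne (by simpa using hk0 i)
      filter_upwards [hev] with t ht
      refine (mem_inverses_diagPencil hQP).mpr
        ⟨k - t • h, ⟨x - t * a, y - t * b, fun i => ?_⟩, ht, rfl⟩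
      simp only [Pi.sub_apply, Pi.smul_apply, smul_eq_mul, hk, hh]
      ring

/-! ### Counting critical points and hyperplane sections -/

/-- Two linear functionals agree on a diagonal pencil if they agree on a spanning pair. -/
theorem forall_isAffineIn_sum_eq_iff (a b : Fin n → ℂ) :
    (∀ h, IsAffineIn lam h → ∑ i, h i * a i = ∑ i, h i * b i) ↔
      ∑ i, a i = ∑ i, b i ∧ ∑ i, lam i * a i = ∑ i, lam i * b i := by
  constructor
  · intro H
    exact ⟨by simpa using H 1 ⟨0, 1, by simp⟩, H lam ⟨1, 0, by simp⟩⟩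
  · rintro ⟨h1, h2⟩ h ⟨x, y, hh⟩
    simp only [hh, add_mul, Finset.sum_add_distrib, mul_assoc, ← Finset.mul_sum, h1, h2]

theorem criticalPoints_diagPencil (hQP : Q * P = 1) (S : Matrix (Fin n) (Fin n) ℂ) :
    criticalPoints (diagPencil Q lam : Set (Matrix (Fin n) (Fin n) ℂ)) S =
      diagCongr Q '' mlSolutions lam (diagEntries Q S) := by
  have key : ∀ k, IsAffineIn lam k → (∀ i, k i ≠ 0) →
      ((∀ T ∈ tangentSpace (diagPencil Q lam : Set (Matrix (Fin n) (Fin n) ℂ)) (diagCongr Q k),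
        dLogLikelihood S (diagCongr Q k) T = 0) ↔
      ∑ i, 1 / k i = ∑ i, diagEntries Q S i ∧
        ∑ i, lam i / k i = ∑ i, diagEntries Q S i * lam i) := by
    intro k hk hk0
    rw [tangentSpace_submodule _ (mem_diagPencil.mpr ⟨k, hk, rfl⟩)]
    have := forall_isAffineIn_sum_eq_iff (lam := lam) (fun i => 1 / k i) (diagEntries Q S)
    simp only [mul_one_div, mul_comm (lam _) (diagEntries Q S _)] at this
    rw [← this]
    constructor
    · intro H h hh
      have := H _ (mem_diagPencil.mpr ⟨h, hh, rfl⟩)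
      rw [dLogLikelihood_diagCongr hQP S hk0] at this
      exact sub_eq_zero.mp this
    · intro H T hT
      obtain ⟨h, hh, rfl⟩ := mem_diagPencil.mp hT
      rw [dLogLikelihood_diagCongr hQP S hk0]
      exact sub_eq_zero.mpr (H h hh)
  ext M
  constructor
  · rintro ⟨hM, hdet, hT⟩
    obtain ⟨k, hk, rfl⟩ := mem_diagPencil.mp hM
    have hk0 := (det_diagCongr_ne_zero_iff hQP).mp hdet
    exact ⟨k, ⟨hk, hk0, (key k hk hk0).mp hT⟩, rfl⟩
  · rintro ⟨k, ⟨hk, hk0, hT⟩, rfl⟩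
    exact ⟨mem_diagPencil.mpr ⟨k, hk, rfl⟩, (det_diagCongr_ne_zero_iff hQP).mpr hk0,
      (key k hk hk0).mpr hT⟩

theorem criticalPoints_reciprocalVariety (hQP : Q * P = 1) (hlam : ∃ i j, lam i ≠ lam j)
    (S : Matrix (Fin n) (Fin n) ℂ) :
    criticalPoints (reciprocalVariety (diagPencil Q lam)) S =
      (fun k => diagCongr P.transpose k⁻¹) ''
        reciprocalMLSolutions lam (diagEntries P.transpose S) := by
  have hR := transpose_mul_transpose_eq_one hQP
  have key : ∀ k, IsAffineIn lam k → (∀ i, k i ≠ 0) →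
      ((∀ T ∈ tangentSpace (reciprocalVariety (diagPencil Q lam)) (diagCongr P.transpose k⁻¹),
        dLogLikelihood S (diagCongr P.transpose k⁻¹) T = 0) ↔
      ∑ i, 1 / k i = ∑ i, diagEntries P.transpose S i / k i ^ 2 ∧
        ∑ i, lam i / k i = ∑ i, diagEntries P.transpose S i * lam i / k i ^ 2) := by
    intro k hk hk0
    generalize hw : diagEntries P.transpose S = w
    have := forall_isAffineIn_sum_eq_iff (lam := lam) (fun i => 1 / k i) (fun i => w i / k i ^ 2)
    simp only [← mul_div_assoc, mul_one, mul_comm (lam _) (w _)] at this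
    rw [← this]
    have hd : ∀ h : Fin n → ℂ, dLogLikelihood S (diagCongr P.transpose k⁻¹)
        (diagCongr P.transpose fun i => h i / k i ^ 2) =
          ∑ i, h i / k i - ∑ i, h i * w i / k i ^ 2 := by
      intro h
      rw [dLogLikelihood_diagCongr hR S (k := k⁻¹) (fun i => inv_ne_zero (hk0 i)), hw]
      congr 1
      · refine Finset.sum_congr rfl fun i _ => ?_
        have := hk0 i
        simp only [Pi.inv_apply]
        field_simp
      · exact Finset.sum_congr rfl fun i _ => by ring
    constructor
    · intro H h hh
      have := H _ ((mem_tangentSpace_reciprocalVariety hQP hlam hk hk0).mpr ⟨h, hh, rfl⟩)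
      rw [hd] at this
      exact sub_eq_zero.mp this
    · intro H T hT
      obtain ⟨h, hh, rfl⟩ := (mem_tangentSpace_reciprocalVariety hQP hlam hk hk0).mp hT
      rw [hd]
      exact sub_eq_zero.mpr (H h hh)
  ext M
  constructor
  · rintro ⟨hM, hdet, hT⟩
    obtain ⟨k, hk, hk0, rfl⟩ :=
      (mem_inverses_diagPencil hQP).mp ((mem_reciprocalVariety_iff hQP hlam hdet).mp hM)
    exact ⟨k, ⟨hk, hk0, (key k hk hk0).mp hT⟩, rfl⟩
  · rintro ⟨k, ⟨hk, hk0, hT⟩, rfl⟩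
    exact ⟨subset_zariskiClosure _ ((mem_inverses_diagPencil hQP).mpr ⟨k, hk, hk0, rfl⟩),
      (det_diagCongr_ne_zero_iff hR).mpr fun i => inv_ne_zero (hk0 i), (key k hk hk0).mpr hT⟩

/-- Bertini's theorem for a linear system that depends on a symmetric matrix `S` through the
diagonal of `Aᵀ * S * A`, where `A` is invertible. -/
theorem forGenericSymm_separable_diagEntries {A B : Matrix (Fin n) (Fin n) ℂ} (hAB : A * B = 1)
    (Φ : (Fin n → ℂ) →ₗ[ℂ] ℂ[X]) {d : ℕ} (hdeg : ∀ w, (Φ w).natDegree ≤ d)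
    (htop : ∃ w, (Φ w).coeff d ≠ 0) (hbase : ∀ y, ∃ w, (Φ w).eval y ≠ 0) (lam : Fin n → ℂ) :
    ForGenericSymm fun S => (Φ (diagEntries A S)).natDegree = d ∧
      (Φ (diagEntries A S)).Separable ∧ ∀ i, (Φ (diagEntries A S)).eval (-lam i) ≠ 0 := by
  have lift : ∀ p : (Fin n → ℂ) → Prop, (∃ w, p w) → ∃ S ∈ symMatrices n, p (diagEntries A S) := by
    rintro p ⟨w, hw⟩
    obtain ⟨S, hS, rfl⟩ := exists_diagEntries_eq hAB w
    exact ⟨S, hS, hw⟩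
  refine (forGenericSymm_separable (Φ.comp (diagEntries A)) (fun S => hdeg _) (lift _ htop)
    (fun y => lift _ (hbase y)) (Finset.univ.image fun i => -lam i)).mono fun S _ hS => ?_
  exact ⟨hS.1, hS.2.1, fun i => hS.2.2 _ (Finset.mem_image_of_mem _ (Finset.mem_univ i))⟩

theorem hasMLDegree_diagPencil (hQP : Q * P = 1) (hlam : ∃ i j, lam i ≠ lam j) :
    HasMLDegree (diagPencil Q lam) ((spectrumFinset lam).card - 1) := by
  have hsum : ForGenericSymm fun S => ∑ i, diagEntries Q S i ≠ 0 := by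
    refine (forGenericSymm_linear_ne_zero ((∑ i, LinearMap.proj i).comp (diagEntries Q)) ?_).mono
      fun S _ hS => by simpa using hS
    obtain ⟨i, -, -⟩ := hlam
    obtain ⟨S, hS, h⟩ := exists_diagEntries_eq hQP (Pi.single i 1)
    exact ⟨S, hS, by simp [h]⟩
  refine (hsum.and (forGenericSymm_separable_diagEntries hQP (mlSystem lam)
    (natDegree_mlSystem_le lam) (exists_coeff_mlSystem_ne_zero lam hlam)
    (exists_eval_mlSystem_ne_zero lam hlam) lam)).mono fun S _ hS => ?_
  rw [criticalPoints_diagPencil hQP, (diagCongr_injective hQP).encard_image,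
    encard_mlSolutions hlam hS.1 hS.2.1 hS.2.2.1 hS.2.2.2]

theorem forGenericSymm_hyperplaneSystem {A B : Matrix (Fin n) (Fin n) ℂ} (hAB : A * B = 1)
    (hlam : ∃ i j, lam i ≠ lam j) :
    ForGenericSymm fun S =>
      (hyperplaneSystem lam (diagEntries A S)).natDegree = (spectrumFinset lam).card - 1 ∧
      (hyperplaneSystem lam (diagEntries A S)).Separable ∧
      ∀ i, (hyperplaneSystem lam (diagEntries A S)).eval (-lam i) ≠ 0 := by
  obtain ⟨i, -, -⟩ := hlam
  have : Nonempty (Fin n) := ⟨i⟩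
  exact forGenericSymm_separable_diagEntries hAB (hyperplaneSystem lam)
    (natDegree_hyperplaneSystem_le lam) (exists_coeff_hyperplaneSystem_ne_zero lam)
    (exists_eval_hyperplaneSystem_ne_zero lam) lam

theorem hasReciprocalMLDegree_diagPencil (hQP : Q * P = 1) (hlam : ∃ i j, lam i ≠ lam j) :
    HasReciprocalMLDegree (diagPencil Q lam) (2 * (spectrumFinset lam).card - 3) := by
  have hR := transpose_mul_transpose_eq_one hQP
  refine ((forGenericSymm_hyperplaneSystem hR hlam).and
    (forGenericSymm_separable_diagEntries hR (reciprocalMLSystem lam)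
    (natDegree_reciprocalMLSystem_le lam) (exists_coeff_reciprocalMLSystem_ne_zero lam hlam)
    (exists_eval_reciprocalMLSystem_ne_zero lam hlam) lam)).mono fun S _ hS => ?_
  have hinj : Function.Injective fun k : Fin n → ℂ => diagCongr P.transpose k⁻¹ :=
    (diagCongr_injective hR).comp inv_injective
  rw [criticalPoints_reciprocalVariety hQP hlam, hinj.encard_image,
    encard_reciprocalMLSolutions hlam hS.2.1 hS.2.2.1 hS.2.2.2 hS.1.2.1]

end DiagonalPencil

section CurveDegree

variable {n : ℕ} {Q P : Matrix (Fin n) (Fin n) ℂ} {lam : Fin n → ℂ}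

theorem smul_mem_inverses (hQP : Q * P = 1) {N : Matrix (Fin n) (Fin n) ℂ}
    (hN : N ∈ inverses (diagPencil Q lam)) {c : ℂ} (hc : c ≠ 0) :
    c • N ∈ inverses (diagPencil Q lam) := by
  obtain ⟨k, ⟨x, y, hk⟩, hk0, rfl⟩ := (mem_inverses_diagPencil hQP).mp hN
  refine (mem_inverses_diagPencil hQP).mpr ⟨c⁻¹ • k, ⟨c⁻¹ * x, c⁻¹ * y, fun i => ?_⟩,
    fun i => mul_ne_zero (inv_ne_zero hc) (hk0 i), ?_⟩
  · simp only [Pi.smul_apply, smul_eq_mul, hk]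
    ring
  · rw [← map_smul]
    congr 1
    funext i
    simp [mul_comm]

/-- A point of the reciprocal curve is represented by the inverse of an element of the pencil or by
a matrix supported on a single eigenvalue. -/
theorem rep_mem_of_mem_reciprocalCurve (hQP : Q * P = 1) (hlam : ∃ i j, lam i ≠ lam j)
    {p : ℙ ℂ (symMatrices n)} (hp : p ∈ reciprocalCurve (diagPencil Q lam)) :
    (p.rep : Matrix (Fin n) (Fin n) ℂ) ∈ inverses (diagPencil Q lam) ∨
      ∃ (i₀ : Fin n) (c : ℂ), (p.rep : Matrix (Fin n) (Fin n) ℂ) =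
        diagCongr P.transpose fun i => if lam i = lam i₀ then c else 0 := by
  have hrep : ∀ q ∈ {p | ∃ (N : symMatrices n) (hN : N ≠ 0),
      (N : Matrix (Fin n) (Fin n) ℂ) ∈ inverses (diagPencil Q lam) ∧
        p = Projectivization.mk ℂ N hN},
      (q.rep : Matrix (Fin n) (Fin n) ℂ) ∈ inverses (diagPencil Q lam) := by
    rintro q ⟨N, hN, hNL, rfl⟩
    obtain ⟨a, ha⟩ := Projectivization.exists_smul_eq_mk_rep ℂ N hN
    rw [← ha]
    exact smul_mem_inverses hQP hNL a.ne_zero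
  refine mem_inverses_or_single hQP hlam (fun i j hij => ?_) (fun i j hij => ?_) fun i j k => ?_
  · rw [← evalAt_linForm]
    refine hp 1 _ (isHomogeneous_linForm _) fun q hq => ?_
    rw [evalAt_linForm]
    exact entryForm_eq_zero_of_mem_inverses hQP (hrep q hq) hij
  · rw [← evalAt_linForm]
    refine hp 1 _ (isHomogeneous_linForm _) fun q hq => ?_
    rw [evalAt_linForm]
    exact entryForm_sub_eq_zero_of_mem_inverses hQP (hrep q hq) hij
  · exact hp 2 _ (isHomogeneous_reciprocalQuadric i j k) fun q hq =>
      evalAt_reciprocalQuadric_of_mem_inverses hQP (hrep q hq) i j k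

theorem diagCongr_ne_zero {A B : Matrix (Fin n) (Fin n) ℂ} (hAB : A * B = 1) {k : Fin n → ℂ}
    {i : Fin n} (hi : k i ≠ 0) : diagCongr A k ≠ 0 := fun h =>
  hi (congrFun (diagCongr_injective hAB (h.trans (map_zero _).symm)) i)

/-- A generic hyperplane avoids the points of the closure that are not inverses, and it meets the
remaining points `((lam + y) ^ (-1))` of the curve in the roots `y` of `hyperplaneSystem`. -/
theorem hasCurveDegree_diagPencil (hQP : Q * P = 1) (hlam : ∃ i j, lam i ≠ lam j) :
    HasCurveDegree (reciprocalCurve (diagPencil Q lam)) ((spectrumFinset lam).card - 1) := by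
  have hR := transpose_mul_transpose_eq_one hQP
  refine (forGenericSymm_hyperplaneSystem hR hlam).mono fun H _ hH => ?_
  obtain ⟨hdeg, hsep, hE⟩ := hH
  generalize hw : diagEntries P.transpose H = w at hdeg hsep hE
  have htrace : ∀ u, (H * diagCongr P.transpose u).trace = ∑ i, u i * w i := fun u => by
    rw [trace_mul_diagCongr, hw]
  obtain ⟨i₀, j₀, hij₀⟩ := hlam
  have hy : ∀ y : {y // (hyperplaneSystem lam w).eval y = 0}, ∀ i, (y : ℂ) + lam i ≠ 0 :=
    fun y => add_ne_zero_of_eval_neg_ne_zero hE y.2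
  let N : {y // (hyperplaneSystem lam w).eval y = 0} → symMatrices n := fun y =>
    ⟨diagCongr P.transpose fun i => ((y : ℂ) + lam i)⁻¹, diagCongr_mem_symMatrices _⟩
  have hN : ∀ y, N y ≠ 0 := fun y h =>
    diagCongr_ne_zero hR (i := i₀) (inv_ne_zero (hy y i₀)) (congrArg Subtype.val h)
  let pt : {y // (hyperplaneSystem lam w).eval y = 0} → ℙ ℂ (symMatrices n) := fun y =>
    Projectivization.mk ℂ (N y) (hN y)
  have hinj : Function.Injective pt := by
    intro y y' h
    obtain ⟨a, ha⟩ := (Projectivization.mk_eq_mk_iff' ℂ _ _ (hN y) (hN y')).mp h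
    have ha : a • diagCongr P.transpose (fun i => ((y' : ℂ) + lam i)⁻¹) =
        diagCongr P.transpose fun i => ((y : ℂ) + lam i)⁻¹ := congrArg Subtype.val ha
    rw [← map_smul] at ha
    have hcoord : ∀ i, a * ((y : ℂ) + lam i) = y' + lam i := by
      intro i
      have := congrFun (diagCongr_injective hR ha) i
      have h1 := hy y i
      have h2 := hy y' i
      simp only [Pi.smul_apply, smul_eq_mul] at this
      field_simp at this
      exact this
    have ha1 : a = 1 := by
      refine mul_right_cancel₀ (sub_ne_zero.mpr hij₀) ?_
      linear_combination hcoord i₀ - hcoord j₀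
    have := hcoord i₀
    rw [ha1, one_mul] at this
    exact Subtype.ext (add_right_cancel this)
  have hrange : {p ∈ reciprocalCurve (diagPencil Q lam) |
      (H * (p.rep : Matrix (Fin n) (Fin n) ℂ)).trace = 0} = Set.range pt := by
    ext p
    constructor
    · rintro ⟨hp, htr⟩
      rcases rep_mem_of_mem_reciprocalCurve hQP ⟨i₀, j₀, hij₀⟩ hp with hrep | ⟨i, c, hrep⟩
      · obtain ⟨k, ⟨x, y, hk⟩, hk0, hrep⟩ := (mem_inverses_diagPencil hQP).mp hrep
        rw [hrep, htrace] at htr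
        have hx : x ≠ 0 := by
          -- The point `x = 0` at infinity is not on the hyperplane, because the leading coefficient
          -- is nonzero.
          rintro rfl
          have hlead : (hyperplaneSystem lam w).coeff ((spectrumFinset lam).card - 1) ≠ 0 := by
            rw [← hdeg, coeff_natDegree, leadingCoeff_ne_zero]
            exact hsep.ne_zero
          refine hlead ?_
          have hy : y ≠ 0 := by simpa [hk] using hk0 i₀
          simp only [Pi.inv_apply, hk, zero_mul, zero_add, ← Finset.mul_sum] at htr
          rw [coeff_hyperplaneSystem]
          exact (mul_eq_zero.mp htr).resolve_left (inv_ne_zero hy)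
        have hk' : ∀ i, k i = x * (y / x + lam i) := by
          intro i
          rw [hk]
          field_simp
          ring
        have hy' : ∀ i, y / x + lam i ≠ 0 := fun i =>
          right_ne_zero_of_mul (hk' i ▸ hk0 i)
        have hroot : (hyperplaneSystem lam w).eval (y / x) = 0 := by
          rw [eval_hyperplaneSystem hy']
          have : ∑ i, w i / (y / x + lam i) = x * ∑ i, k⁻¹ i * w i := by
            rw [Finset.mul_sum]
            refine Finset.sum_congr rfl fun i _ => ?_
            rw [Pi.inv_apply, hk']
            have := hy' i
            generalize y / x + lam i = z at *
            field_simp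
          rw [this, htr, mul_zero, mul_zero]
        refine ⟨⟨y / x, hroot⟩, ?_⟩
        rw [← p.mk_rep]
        refine (Projectivization.mk_eq_mk_iff' ℂ _ _ _ _).mpr ⟨x, Subtype.ext ?_⟩
        change x • (p.rep : Matrix (Fin n) (Fin n) ℂ) =
          diagCongr P.transpose fun i => (y / x + lam i)⁻¹
        rw [hrep, ← map_smul]
        congr 1
        funext i
        rw [Pi.smul_apply, Pi.inv_apply, hk', smul_eq_mul, mul_inv, mul_inv_cancel_left₀ hx]
      · -- The trace against a matrix supported on the eigenvalue `lam i` is, up to a nonzero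
        -- factor, the value of `hyperplaneSystem` at `-lam i`.
        exfalso
        have hc : c ≠ 0 := by
          rintro rfl
          refine p.rep_nonzero (Subtype.ext (hrep.trans ?_))
          simp only [ite_self]
          exact map_zero _
        rw [hrep, htrace] at htr
        refine hE i ?_
        rw [eval_hyperplaneSystem_neg]
        have : ∑ j, (if lam j = lam i then c else 0) * w j =
            c * ∑ j, if lam j = lam i then w j else 0 := by
          rw [Finset.mul_sum]
          exact Finset.sum_congr rfl fun j _ => by split_ifs <;> simp
        rw [this] at htr
        rw [(mul_eq_zero.mp htr).resolve_left hc, zero_mul]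
    · rintro ⟨y, rfl⟩
      refine ⟨fun d F _ hF => hF _ ⟨N y, hN y, ?_, rfl⟩, ?_⟩
      · exact (mem_inverses_diagPencil hQP).mpr
          ⟨fun i => y + lam i, ⟨1, y, fun i => by ring⟩, hy y, rfl⟩
      · obtain ⟨a, ha⟩ := Projectivization.exists_smul_eq_mk_rep ℂ (N y) (hN y)
        have hy0 := y.2
        rw [eval_hyperplaneSystem (hy y)] at hy0
        have hy0 := (mul_eq_zero.mp hy0).resolve_left (eval_fullProd_ne_zero (hy y))
        change (H * ((Projectivization.mk ℂ (N y) (hN y)).rep : Matrix _ _ ℂ)).trace = 0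
        rw [← ha]
        change (H * ((a : ℂ) • diagCongr P.transpose fun i => ((y : ℂ) + lam i)⁻¹)).trace = 0
        rw [Matrix.mul_smul, Matrix.trace_smul, htrace]
        have : ∑ i, ((y : ℂ) + lam i)⁻¹ * w i = ∑ i, w i / (y + lam i) :=
          Finset.sum_congr rfl fun i _ => by ring
        rw [this, hy0, smul_zero]
  rw [hrange, ← Set.image_univ, hinj.encard_image, Set.encard_univ, ← hdeg]
  exact encard_roots_of_separable hsep

end CurveDegree

/-! ### Simultaneous diagonalisation of a d-pencil -/

section Diagonalisation

variable {n : ℕ} {L : Submodule ℝ (Matrix (Fin n) (Fin n) ℝ)}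

open scoped MatrixOrder Matrix.Norms.L2Operator in
/-- A symmetric and a positive definite real matrix are simultaneously congruent to a diagonal
matrix and the identity. -/
theorem exists_simultaneous_diagonalisation {A B : Matrix (Fin n) (Fin n) ℝ} (hA : A.IsSymm)
    (hB : B.PosDef) : ∃ (Q : Matrix (Fin n) (Fin n) ℝ) (d : Fin n → ℝ), Q.det ≠ 0 ∧
      B = Q * Q.transpose ∧ A = Q * Matrix.diagonal d * Q.transpose := by
  obtain ⟨C, hC⟩ : ∃ C : Matrix (Fin n) (Fin n) ℝ, B = C.transpose * C := by
    obtain ⟨C, hC⟩ := CStarAlgebra.nonneg_iff_eq_star_mul_self.mp hB.posSemidef.nonneg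
    exact ⟨C, by simpa [Matrix.star_eq_conjTranspose] using hC⟩
  have hCdet : IsUnit C.det := by
    rw [isUnit_iff_ne_zero]
    intro h
    have := hB.det_pos
    simp [hC, h] at this
  have hG : (C⁻¹.transpose * A * C⁻¹).IsHermitian := by
    simp [Matrix.IsHermitian, Matrix.conjTranspose_eq_transpose_of_trivial, Matrix.mul_assoc, hA.eq]
  have hspec := hG.spectral_theorem
  rw [Unitary.conjStarAlgAut_apply] at hspec
  set U : Matrix (Fin n) (Fin n) ℝ := hG.eigenvectorUnitary.val
  have hUU : U * U.transpose = 1 := by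
    have := Unitary.coe_mul_star_self hG.eigenvectorUnitary
    simpa [Matrix.star_eq_conjTranspose, Matrix.conjTranspose_eq_transpose_of_trivial] using this
  have hCt : C.transpose * C⁻¹.transpose = 1 := by
    rw [← Matrix.transpose_mul, Matrix.nonsing_inv_mul _ hCdet, Matrix.transpose_one]
  refine ⟨C.transpose * U, hG.eigenvalues, ?_, ?_, ?_⟩
  · rw [Matrix.det_mul, Matrix.det_transpose]
    refine mul_ne_zero hCdet.ne_zero fun h => ?_
    have := congrArg Matrix.det hUU
    simp [h] at this
  · rw [Matrix.transpose_mul, Matrix.transpose_transpose, hC]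
    calc C.transpose * C = C.transpose * (U * U.transpose) * C := by rw [hUU, Matrix.mul_one]
      _ = _ := by simp only [Matrix.mul_assoc]
  · calc A = (C.transpose * C⁻¹.transpose) * A * (C⁻¹ * C) := by
          rw [hCt, Matrix.nonsing_inv_mul _ hCdet, Matrix.one_mul, Matrix.mul_one]
      _ = C.transpose * (C⁻¹.transpose * A * C⁻¹) * C := by simp only [Matrix.mul_assoc]
      _ = C.transpose * (U * Matrix.diagonal hG.eigenvalues * U.transpose) * C :=
        congrArg (fun G => C.transpose * G * C) hspec
      _ = _ := by simp only [Matrix.mul_assoc, Matrix.transpose_mul, Matrix.transpose_transpose]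

/-- A two-dimensional space is spanned by any nonzero element together with another one. -/
theorem exists_spanning_pair (hL : Module.finrank ℝ L = 2) {B : Matrix (Fin n) (Fin n) ℝ}
    (hB : B ∈ L) (hB0 : B ≠ 0) :
    ∃ A ∈ L, LinearIndependent ℝ ![B, A] ∧ ∀ M ∈ L, ∃ x y : ℝ, x • B + y • A = M := by
  have hB' : (⟨B, hB⟩ : L) ≠ 0 := fun h => hB0 (congrArg Subtype.val h)
  obtain ⟨A, hA⟩ := exists_linearIndependent_pair_of_one_lt_finrank (R := ℝ) (by omega) hB'
  refine ⟨A, A.2, ?_, fun M hM => ?_⟩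
  · have := hA.map' L.subtype (Submodule.ker_subtype L)
    have hcomp : L.subtype ∘ ![⟨B, hB⟩, A] = ![B, A] := by
      funext i
      fin_cases i <;> rfl
    rwa [hcomp] at this
  · have : FiniteDimensional ℝ L := Module.finite_of_finrank_pos (by omega)
    have htop := hA.span_eq_top_of_card_eq_finrank' (by simp [hL])
    have hM' : (⟨M, hM⟩ : L) ∈ Submodule.span ℝ (Set.range ![⟨B, hB⟩, A]) := by
      rw [htop]; trivial
    rw [Matrix.range_cons_cons_empty, Submodule.mem_span_pair] at hM'
    obtain ⟨x, y, h⟩ := hM'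
    exact ⟨x, y, congrArg Subtype.val h⟩

theorem IsDPencil.exists_linearIndependent_pair (hL : IsDPencil L) :
    ∃ B ∈ L, ∃ A ∈ L, B.PosDef ∧ LinearIndependent ℝ ![B, A] ∧
      ∀ M ∈ L, ∃ x y : ℝ, x • B + y • A = M := by
  obtain ⟨B, hB, hpos⟩ := hL.exists_posDef
  have hB0 : B ≠ 0 := by
    rintro rfl
    have hn : IsEmpty (Fin n) := by
      by_contra h
      rw [not_isEmpty_iff] at h
      simpa using hpos.det_pos
    have : Subsingleton L := inferInstance
    have := hL.finrank_eq
    rw [Module.finrank_zero_of_subsingleton] at this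
    omega
  obtain ⟨A, hA, hind, hspan⟩ := exists_spanning_pair hL.finrank_eq hB hB0
  exact ⟨B, hB, A, hA, hpos, hind, hspan⟩

theorem IsDPencil.exists_diagCongr (hL : IsDPencil L) :
    ∃ Q P : Matrix (Fin n) (Fin n) ℂ, Q * P = 1 ∧
      complexify L ≤ LinearMap.range (diagCongr Q) := by
  obtain ⟨B, -, A, hA, hpos, -, hspan⟩ := hL.exists_linearIndependent_pair
  obtain ⟨Q, d, hdet, hBQ, hAQ⟩ := exists_simultaneous_diagonalisation (hL.isSymm A hA) hpos
  have hmap : ∀ M N : Matrix (Fin n) (Fin n) ℝ,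
      (M * N).map Complex.ofReal = M.map Complex.ofReal * N.map Complex.ofReal := fun M N =>
    Matrix.map_mul (f := Complex.ofRealHom)
  refine ⟨Q.map Complex.ofReal, Q⁻¹.map Complex.ofReal, ?_, Submodule.span_le.mpr ?_⟩
  · rw [← hmap, Matrix.mul_nonsing_inv Q (isUnit_iff_ne_zero.mpr hdet)]
    exact Matrix.map_one _ Complex.ofReal_zero Complex.ofReal_one
  · rintro _ ⟨M, hM, rfl⟩
    obtain ⟨x, y, rfl⟩ := hspan M hM
    refine ⟨fun i => ((x + y * d i : ℝ) : ℂ), ?_⟩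
    have hcomb : x • B + y • A = Q * Matrix.diagonal (fun i => x + y * d i) * Q.transpose := by
      rw [hAQ, hBQ]
      have : Matrix.diagonal (fun i => x + y * d i) = x • 1 + y • Matrix.diagonal d := by
        rw [← Matrix.diagonal_one, ← Matrix.diagonal_smul, ← Matrix.diagonal_smul,
          Matrix.diagonal_add]
        simp
      rw [this]
      simp [Matrix.mul_add, Matrix.add_mul]
    change _ = (x • B + y • A).map Complex.ofReal
    rw [hcomb, diagCongr_apply]
    rw [hmap, hmap, Matrix.diagonal_map Complex.ofReal_zero]
    rfl

/-- The complexification of a two-dimensional real space is not contained in a line. -/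
theorem IsDPencil.not_complexify_le_span_singleton (hL : IsDPencil L)
    (B : Matrix (Fin n) (Fin n) ℂ) : ¬ complexify L ≤ Submodule.span ℂ {B} := by
  intro hle
  obtain ⟨M, hM, N, hN, -, hind, -⟩ := hL.exists_linearIndependent_pair
  have hmem : ∀ M ∈ L, ∃ c : ℂ, ∀ i j, (M i j : ℂ) = c * B i j := by
    intro M hM
    obtain ⟨c, hc⟩ := Submodule.mem_span_singleton.mp
      (hle (Submodule.subset_span (Set.mem_image_of_mem _ hM)))
    exact ⟨c, fun i j => by simpa using (congrFun (congrFun hc i) j).symm⟩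
  obtain ⟨c, hc⟩ := hmem M hM
  obtain ⟨c', hc'⟩ := hmem N hN
  rw [LinearIndependent.pair_iff] at hind
  -- Two multiples of `B` are proportional with ratio `N a b / M a b`, which is real.
  have hM0 : ∀ a b, M a b = 0 := by
    intro a b
    have hcomb : -(N a b) • M + M a b • N = 0 := by
      ext i j
      have : -((N a b : ℂ)) * M i j + M a b * N i j = 0 := by
        rw [hc, hc, hc', hc']
        ring
      simpa using (by exact_mod_cast this : -(N a b) * M i j + M a b * N i j = 0)
    exact (hind _ _ hcomb).2
  have : (1 : ℝ) • M + (0 : ℝ) • N = 0 := by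
    ext i j
    simp [hM0]
  exact one_ne_zero (hind _ _ this).1

/-- With respect to a spanning pair `A, B` with `B` invertible, the congruence can be rescaled by
square roots so that `B` becomes the identity; the diagonal of `A` then lists the eigenvalues. -/
theorem IsDPencil.exists_eq_diagPencil (hL : IsDPencil L) {r : ℕ}
    (hr : HasDistinctEigenvalues (complexify L) r) :
    ∃ (Q P : Matrix (Fin n) (Fin n) ℂ) (lam : Fin n → ℂ), Q * P = 1 ∧
      complexify L = diagPencil Q lam ∧ (∃ i j, lam i ≠ lam j) ∧
      (spectrumFinset lam).card = r := by
  obtain ⟨A, B, hspan, hdet, hcard⟩ := hr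
  obtain ⟨Q, P, hQP, hle⟩ := hL.exists_diagCongr
  obtain ⟨a, ha⟩ := hle (hspan ▸ Submodule.subset_span (by simp) : A ∈ complexify L)
  obtain ⟨b, hb⟩ := hle (hspan ▸ Submodule.subset_span (by simp) : B ∈ complexify L)
  have hb0 : ∀ i, b i ≠ 0 := (det_diagCongr_ne_zero_iff hQP).mp (hb ▸ hdet)
  choose β hβ using fun i => IsAlgClosed.exists_pow_nat_eq (b i) (n := 2) two_pos
  have hβ0 : ∀ i, β i ≠ 0 := fun i h => hb0 i (by rw [← hβ, h]; simp)
  have hscale : ∀ k, diagCongr (Q * Matrix.diagonal β) k = diagCongr Q (b * k) := by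
    intro k
    simp only [diagCongr_apply, Matrix.transpose_mul, Matrix.diagonal_transpose]
    have : Matrix.diagonal (b * k) = Matrix.diagonal β * Matrix.diagonal k * Matrix.diagonal β := by
      rw [Matrix.diagonal_mul_diagonal, Matrix.diagonal_mul_diagonal]
      congr 1
      funext i
      rw [Pi.mul_apply, ← hβ]
      ring
    rw [this]
    simp only [Matrix.mul_assoc]
  have hQP' : Q * Matrix.diagonal β * (Matrix.diagonal β⁻¹ * P) = 1 := by
    have : Matrix.diagonal β * Matrix.diagonal β⁻¹ = 1 := by
      rw [Matrix.diagonal_mul_diagonal, ← Matrix.diagonal_one]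
      congr 1
      funext i
      simp [hβ0 i]
    rw [Matrix.mul_assoc, ← Matrix.mul_assoc (Matrix.diagonal β), this, Matrix.one_mul, hQP]
  have hA : A = diagCongr (Q * Matrix.diagonal β) (a / b) := by
    rw [hscale, ← ha]
    congr 1
    funext i
    simp [mul_div_cancel₀, hb0 i]
  have hB : B = diagCongr (Q * Matrix.diagonal β) 1 := by
    rw [hscale, mul_one, hb]
  refine ⟨_, _, a / b, hQP', ?_, ?_, ?_⟩
  · rw [hspan, diagPencil, ← hA, ← hB]
  · by_contra! hconst
    refine hL.not_complexify_le_span_singleton B ?_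
    have : ∃ c : ℂ, A = c • B := by
      rcases isEmpty_or_nonempty (Fin n) with h | ⟨⟨i⟩⟩
      · exact ⟨0, Subsingleton.elim _ _⟩
      · refine ⟨(a / b) i, ?_⟩
        rw [hA, hB, ← map_smul]
        congr 1
        funext j
        simp [hconst j i]
    obtain ⟨c, hc⟩ := this
    rw [hspan, Submodule.span_le]
    rintro M (rfl | rfl)
    · rw [hc]
      exact Submodule.smul_mem _ _ (Submodule.mem_span_singleton_self B)
    · exact Submodule.mem_span_singleton_self _
  · have hroots : {α : ℂ | (A - α • B).det = 0} = (spectrumFinset (a / b) : Set ℂ) := by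
      ext α
      have : A - α • B = diagCongr (Q * Matrix.diagonal β) (a / b - α • 1) := by
        rw [map_sub, map_smul, ← hA, ← hB]
      have h2 := (det_diagCongr_ne_zero_iff hQP' (k := a / b - α • 1)).not
      rw [← this] at h2
      simp only [not_not, not_forall] at h2
      simp only [Set.mem_ofPred_eq, h2, spectrumFinset]
      simp [sub_eq_zero]
    rw [hroots, Set.encard_coe_eq_coe_finsetCard] at hcard
    exact_mod_cast hcard

theorem IsRealPencil.isDPencil (hL : IsRealPencil L)
    (h : (linearConcentrationModel L).Nonempty ∨ (linearCovarianceModel L).Nonempty) :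
    IsDPencil L := by
  refine ⟨hL, ?_⟩
  rcases h with ⟨_, _, C, hC, hCL, -⟩ | ⟨_, _, C, hC, hCL, -⟩
  · exact ⟨C⁻¹, hCL, hC.inv⟩
  · exact ⟨C, hCL, hC⟩

end Diagonalisation

end Pencil

theorem mainTheorem3 (n : ℕ) (L : Submodule ℝ (Matrix (Fin n) (Fin n) ℝ)) :
    (Pencil.IsDPencil L →
      ∀ r : ℕ, Pencil.HasDistinctEigenvalues (Pencil.complexify L) r →
        2 ≤ r ∧
        Pencil.HasMLDegree (Pencil.complexify L) (r - 1) ∧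
        Pencil.HasCurveDegree (Pencil.reciprocalCurve (Pencil.complexify L)) (r - 1) ∧
        Pencil.HasReciprocalMLDegree (Pencil.complexify L) (2 * r - 3)) ∧
    (Pencil.IsRealPencil L →
      ((Pencil.linearConcentrationModel L).Nonempty ∨
        (Pencil.linearCovarianceModel L).Nonempty) →
      Pencil.IsDPencil L) := by
  refine ⟨fun hL r hr => ?_, Pencil.IsRealPencil.isDPencil⟩
  obtain ⟨Q, P, lam, hQP, hspan, hlam, rfl⟩ := hL.exists_eq_diagPencil hr
  rw [hspan]
  refine ⟨?_, Pencil.hasMLDegree_diagPencil hQP hlam, Pencil.hasCurveDegree_diagPencil hQP hlam,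
    Pencil.hasReciprocalMLDegree_diagPencil hQP hlam⟩
  obtain ⟨i, j, hij⟩ := hlam
  exact Finset.one_lt_card.mpr ⟨_, Pencil.mem_spectrumFinset lam i, _,
    Pencil.mem_spectrumFinset lam j, hij⟩
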